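/- Let $H$ be the group of permutations of $\mathbb{Z}$ generated by the transposition $(0\,1)$ and the shift $j\mapsto j+1$. For $i\ge 1$ let $H_i\le H$ be the group of all permutations supported on $[-i,i]$, let $H_\omega=\bigcup_i H_i$, let $V_i$ be the group of maps $\mathbb{Z}\to\{\pm1\}$ that equal $1$ outside $[-i,i]$, and let $G_i=V_i\rtimes H_i$ with $({}^h v)(j)=v(h^{-1}(j))$. Let $z_i\in V_i$ be the map equal to $-1$ on $[-i,i]$ and to $1$ elsewhere, and let $K_i=\langle z_i\rangle\times H_i$, regarded as a subgroup both of $G_i$ and of $G_{i+1}$. Dunwoody's (inaccessible) group is the amalgamated free product \[J=\bigl(G_1*_{K_1}G_2*_{K_2}G_3*_{K_3}\cdots\bigr)*_{H_\omega}H .\] An action of a group $G$ by isometries on a metric space $X$ is acylindrical if for every $\epsilon>0$ there are $M,N\ge 0$ such that for all $x,y\in X$ with $d(x,y)\ge M$ at most $N$ elements $g\in G$ satisfy $d(x,gx)\le\epsilon$ and $d(y,gy)\le\epsilon$. A hyperbolic space is a non-empty geodesic metric space that is Gromov hyperbolic. An element $g$ is loxodromic for an action on $X$ if $n\mapsto g^n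 x$ is a quasi-isometric embedding $\mathbb{Z}\to X$ for some $x\in X$, and it is generalized loxodromic if it is loxodromic for some acylindrical action of $G$ on a hyperbolic space. **Theorem.** Dunwoody's group $J$ is finitely generated and has no universal acylindrical action: there is no acylindrical action of $J$ on a hyperbolic space for which all generalized loxodromic elements of $J$ are loxodromic. -/

import Mathlib

/-! ### Acylindrical actions on hyperbolic spaces -/

/-- A metric space is geodesic if any two points are joined by an isometrically embedded
segment. -/
def IsGeodesicSpace (X : Type*) [MetricSpace X] : Prop :=
  ∀ x y : X, ∃ γ : ℝ → X, γ 0 = x ∧ γ (dist x y) = y ∧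
    ∀ s ∈ Set.Icc 0 (dist x y), ∀ t ∈ Set.Icc 0 (dist x y), dist (γ s) (γ t) = |s - t|

/-- The Gromov product `(x | y)_w`. -/
noncomputable def gromovProduct {X : Type*} [MetricSpace X] (w x y : X) : ℝ :=
  (dist x w + dist y w - dist x y) / 2

/-- A hyperbolic space: a non-empty geodesic metric space which is `δ`-hyperbolic in the sense of
Gromov for some `δ ≥ 0`. -/
structure IsHyperbolicSpace (X : Type*) [MetricSpace X] : Prop where
  nonempty : Nonempty X
  geodesic : IsGeodesicSpace X
  hyperbolic : ∃ δ : ℝ, 0 ≤ δ ∧ ∀ w x y z : X,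
    min (gromovProduct w x y) (gromovProduct w y z) - δ ≤ gromovProduct w x z

/-- The action of `G` on the metric space `X` is acylindrical. -/
def IsAcylindricalAction (G X : Type*) [Group G] [MetricSpace X] [MulAction G X] : Prop :=
  ∀ ε : ℝ, 0 < ε → ∃ (M : ℝ) (N : ℕ), 0 ≤ M ∧ ∀ x y : X, M ≤ dist x y →
    {g : G | dist x (g • x) ≤ ε ∧ dist y (g • y) ≤ ε}.encard ≤ N

/-- Quasi-isometric embeddings of metric spaces. -/
def IsQuasiIsometricEmbedding {X Y : Type*} [MetricSpace X] [MetricSpace Y] (f : X → Y) : Prop :=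
  ∃ L C : ℝ, 1 ≤ L ∧ 0 ≤ C ∧ ∀ a b : X,
    dist a b / L - C ≤ dist (f a) (f b) ∧ dist (f a) (f b) ≤ L * dist a b + C

/-- `g` acts loxodromically on `X`: for some point `x` of `X` the map `n ↦ g ^ n • x` is a
quasi-isometric embedding of `ℤ` in `X`. -/
def IsLoxodromic {G : Type*} (X : Type*) [Group G] [MetricSpace X] [MulAction G X] (g : G) :
    Prop :=
  ∃ x : X, IsQuasiIsometricEmbedding fun n : ℤ => g ^ n • x

universe u v w

/-- `g` is generalized loxodromic: it is loxodromic for some acylindrical action of `G` by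
isometries on a hyperbolic space (with underlying type in the universe `v`). -/
def IsGeneralizedLoxodromic {G : Type w} [Group G] (g : G) : Prop :=
  ∃ (X : Type v) (_ : MetricSpace X) (_ : MulAction G X),
    IsIsometricSMul G X ∧ IsHyperbolicSpace X ∧ IsAcylindricalAction G X ∧ IsLoxodromic X g

/-- `G` has a universal acylindrical action: an acylindrical action by isometries on a hyperbolic
space (with underlying type in the universe `u`) for which every generalized loxodromic element of
`G` is loxodromic. -/
def HasUniversalAcylindricalAction (G : Type w) [Group G] : Prop :=
  ∃ (X : Type u) (_ : MetricSpace X) (_ : MulAction G X),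
    IsIsometricSMul G X ∧ IsHyperbolicSpace X ∧ IsAcylindricalAction G X ∧
      ∀ g : G, IsGeneralizedLoxodromic.{v} g → IsLoxodromic X g

/-! ### Dunwoody's group -/

namespace Dunwoody

/-- The group `H` of permutations of `ℤ` generated by the transposition `(0 1)` and the shift
`j ↦ j + 1`. -/
def H : Subgroup (Equiv.Perm ℤ) :=
  Subgroup.closure {Equiv.swap 0 1, Equiv.addRight 1}

/-- The group `H_i` of permutations of `ℤ` supported on `[-i, i]`. -/
def Hfin (i : ℕ) : Subgroup (Equiv.Perm ℤ) where
  carrier := {h | ∀ j : ℤ, j ∉ Set.Icc (-(i : ℤ)) i → h j = j}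
  one_mem' := fun _ _ => rfl
  mul_mem' := fun {a b} ha hb j hj => by
    rw [Equiv.Perm.mul_apply, hb j hj, ha j hj]
  inv_mem' := fun {a} ha j hj => by
    rw [Equiv.Perm.inv_eq_iff_eq, ha j hj]

/-- The group `V` of maps `ℤ → {1, -1}`, under pointwise multiplication. -/
abbrev V : Type := ℤ → ℤˣ

/-- The group `V_i` of maps `ℤ → {1, -1}` supported on `[-i, i]`. -/
def Vfin (i : ℕ) : Subgroup V where
  carrier := {v | ∀ j : ℤ, j ∉ Set.Icc (-(i : ℤ)) i → v j = 1}
  one_mem' := fun _ _ => rfl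
  mul_mem' := fun {a b} ha hb j hj => by
    rw [Pi.mul_apply, ha j hj, hb j hj, one_mul]
  inv_mem' := fun {a} ha j hj => by
    rw [Pi.inv_apply, ha j hj, inv_one]

/-- The element `z_i` of `V_i`, equal to `-1` on `[-i, i]` and to `1` elsewhere. -/
def z (i : ℕ) : V := fun j => if -(i : ℤ) ≤ j ∧ j ≤ i then -1 else 1

/-- The action of the permutations of `ℤ` on `V`, given by `(h • v) j = v (h⁻¹ j)`. -/
def permAction : Equiv.Perm ℤ →* MulAut V := mulAutArrow

theorem permAction_apply (h : Equiv.Perm ℤ) (v : V) (j : ℤ) : permAction h v j = v (h⁻¹ j) := rfl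

/-- The semidirect product of `V` with the group of all permutations of `ℤ`. It contains all the
groups `V_i ⋊ H_i`. -/
abbrev W : Type := V ⋊[permAction] Equiv.Perm ℤ

/-- The subgroup `N ⋊ P` of `W`, where the subgroup `P` of permutations normalizes `N ≤ V`. -/
def semidirect (N : Subgroup V) (P : Subgroup (Equiv.Perm ℤ))
    (hNP : ∀ h ∈ P, ∀ v ∈ N, permAction h v ∈ N) : Subgroup W where
  carrier := {x | x.left ∈ N ∧ x.right ∈ P}
  one_mem' := ⟨N.one_mem, P.one_mem⟩
  mul_mem' := fun ha hb =>
    ⟨N.mul_mem ha.1 (hNP _ ha.2 _ hb.1), P.mul_mem ha.2 hb.2⟩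
  inv_mem' := fun ha =>
    ⟨hNP _ (P.inv_mem ha.2) _ (N.inv_mem ha.1), P.inv_mem ha.2⟩

theorem Hfin_apply_mem_iff {i : ℕ} {h : Equiv.Perm ℤ} (hh : h ∈ Hfin i) (j : ℤ) :
    h j ∈ Set.Icc (-(i : ℤ)) i ↔ j ∈ Set.Icc (-(i : ℤ)) i := by
  constructor
  · intro hj
    by_contra hn
    exact hn (hh j hn ▸ hj)
  · intro hj
    by_contra hn
    exact hn (by rwa [h.injective (hh (h j) hn)])

theorem permAction_mem_Vfin (i : ℕ) :
    ∀ h ∈ Hfin i, ∀ v ∈ Vfin i, permAction h v ∈ Vfin i := by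
  intro h hh v hv j hj
  rw [permAction_apply]
  exact hv _ fun hn => hj ((Hfin_apply_mem_iff ((Hfin i).inv_mem hh) j).1 hn)

theorem permAction_z (i : ℕ) {h : Equiv.Perm ℤ} (hh : h ∈ Hfin i) : permAction h (z i) = z i := by
  funext j
  rw [permAction_apply]
  exact if_congr (Hfin_apply_mem_iff ((Hfin i).inv_mem hh) j) rfl rfl

theorem permAction_mem_zpowers (i : ℕ) :
    ∀ h ∈ Hfin i, ∀ v ∈ Subgroup.zpowers (z i), permAction h v ∈ Subgroup.zpowers (z i) := by
  rintro h hh _ ⟨n, rfl⟩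
  exact ⟨n, by simp [permAction_z i hh]⟩

/-- The group `G_i = V_i ⋊ H_i`. -/
def G (i : ℕ) : Subgroup W := semidirect (Vfin i) (Hfin i) (permAction_mem_Vfin i)

/-- The group `K_i = ⟨z_i⟩ × H_i`, with `⟨z_i⟩ ≤ V_i`. -/
def K (i : ℕ) : Subgroup W :=
  semidirect (Subgroup.zpowers (z i)) (Hfin i) (permAction_mem_zpowers i)

theorem z_mem_Vfin (i : ℕ) : z i ∈ Vfin i := fun _ hj => if_neg hj

theorem Icc_subset_succ (i : ℕ) :
    Set.Icc (-(i : ℤ)) i ⊆ Set.Icc (-((i + 1 : ℕ) : ℤ)) ((i + 1 : ℕ) : ℤ) :=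
  Set.Icc_subset_Icc (by push_cast; omega) (by push_cast; omega)

theorem Vfin_le_succ (i : ℕ) : Vfin i ≤ Vfin (i + 1) :=
  fun _ hv j hj => hv j fun hn => hj (Icc_subset_succ i hn)

theorem Hfin_le_succ (i : ℕ) : Hfin i ≤ Hfin (i + 1) :=
  fun _ hh j hj => hh j fun hn => hj (Icc_subset_succ i hn)

theorem K_le_G (i : ℕ) : K i ≤ G i :=
  fun _ hx => ⟨(Subgroup.zpowers_le.2 (z_mem_Vfin i)) hx.1, hx.2⟩

theorem K_le_G_succ (i : ℕ) : K i ≤ G (i + 1) :=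
  fun _ hx => ⟨Vfin_le_succ i ((Subgroup.zpowers_le.2 (z_mem_Vfin i)) hx.1),
    Hfin_le_succ i hx.2⟩

theorem swap_succ_mem_H (k : ℤ) : Equiv.swap k (k + 1) ∈ H := by
  have hs : (Equiv.addRight (1 : ℤ)) ∈ H := Subgroup.subset_closure (by simp)
  have h0 : Equiv.swap (0 : ℤ) 1 ∈ H := Subgroup.subset_closure (by simp)
  have h := H.mul_mem (H.mul_mem (H.zpow_mem hs k) h0) (H.inv_mem (H.zpow_mem hs k))
  have e : ((Equiv.addRight (1 : ℤ)) ^ k : Equiv.Perm ℤ) = Equiv.addRight k := by simp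
  rw [e, ← Equiv.swap_apply_apply] at h
  simpa [add_comm] using h

theorem swap_mem_H (a b : ℤ) : Equiv.swap a b ∈ H := by
  have key : ∀ (n : ℕ) (a : ℤ), Equiv.swap a (a + n) ∈ H := by
    intro n
    induction n with
    | zero => intro a; rw [Nat.cast_zero, add_zero, Equiv.swap_self]; exact H.one_mem
    | succ n ih =>
      intro a
      have h := SubmonoidClass.swap_mem_trans H (ih a) (swap_succ_mem_H (a + n))
      rwa [add_assoc] at h
  rcases le_total a b with hab | hab
  · obtain ⟨n, rfl⟩ := Int.le.dest hab
    exact key n a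
  · obtain ⟨n, rfl⟩ := Int.le.dest hab
    rw [Equiv.swap_comm]
    exact key n b

theorem Hfin_le_H (i : ℕ) : Hfin i ≤ H := by
  intro h hh
  have hmem : h ∈ Subgroup.closure {σ : Equiv.Perm ℤ | σ.IsSwap} := by
    rw [_root_.mem_closure_isSwap']
    refine (Set.finite_Icc (-(i : ℤ)) i).subset fun j hj => ?_
    by_contra hn
    exact hj (hh j hn)
  refine (Subgroup.closure_le H).2 ?_ hmem
  rintro _ ⟨a, b, -, rfl⟩
  exact swap_mem_H a b

/-- The free product of `G_1, G_2, G_3, …` and `H`. The factor of index `n` is `G_{n+1}`. -/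
abbrev FreeProd : Type := Monoid.Coprod (Monoid.CoprodI fun n : ℕ => G (n + 1)) H

/-- The inclusion of the factor `G_{n+1}` in the free product. -/
def inG (n : ℕ) : G (n + 1) →* FreeProd :=
  Monoid.Coprod.inl.comp (Monoid.CoprodI.of (M := fun n : ℕ => G (n + 1)) (i := n))

/-- The inclusion of the factor `H` in the free product. -/
def inH : H →* FreeProd := Monoid.Coprod.inr

/-- The inclusion of `H_i` in `G_i = V_i ⋊ H_i`. -/
def HfinToG (i : ℕ) : Hfin i →* G i :=
  (SemidirectProduct.inr.comp (Hfin i).subtype).codRestrict (G i)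
    fun h => ⟨(Vfin i).one_mem, h.2⟩

/-- The identifications which define Dunwoody's group: for all `i ≥ 1`, the copies of `K_i` in
`G_i` and in `G_{i+1}` are identified, and so are the copies of `H_i` in `G_i` and in `H`. -/
def relators : Set FreeProd :=
  {r | ∃ (n : ℕ) (k : K (n + 1)), r =
      inG n (Subgroup.inclusion (K_le_G (n + 1)) k) *
        (inG (n + 1) (Subgroup.inclusion (K_le_G_succ (n + 1)) k))⁻¹} ∪
  {r | ∃ (n : ℕ) (h : Hfin (n + 1)), r =
      inG n (HfinToG (n + 1) h) * (inH (Subgroup.inclusion (Hfin_le_H (n + 1)) h))⁻¹}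

/-- Dunwoody's group `J = (G_1 *_{K_1} G_2 *_{K_2} G_3 *_{K_3} ⋯) *_{H_ω} H`, where `H_ω` is the
union of the groups `H_i`: the free product of the groups `G_i` (`i ≥ 1`) and of `H`, modulo the
identifications of the amalgamated subgroups. -/
abbrev J : Type := FreeProd ⧸ Subgroup.normalClosure relators

end Dunwoody

/-! An acylindrical action on a hyperbolic space limits how much finite symmetry a loxodromic
element can have. A finite subgroup `F` has a point `x` moved at most `C` by all of `F`, with `C`
independent of `F`. The elements of `F` that commute with `g` then move every `g ^ n • x` at most
`C`. If there are more of them than acylindricity allows at scale `C`, the orbit of `x` under `g` is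
bounded and `g` is not loxodromic (`IsAcylindricalAction.exists_not_isLoxodromic`).

In `J` there is no such limit. For every `n` the group splits over the finite group `K (n + 1)`. A
sign change `a` at `0` and a sign change `b` at `n + 2` lie on different sides, outside the edge
group, so `a * b` is hyperbolic on the Bass–Serre tree, on which `J` acts acylindrically. Both
commute with the `n` transpositions of `1` with `2, …, n + 1`, which lie in a finite subgroup
(`Dunwoody.exists_isGeneralizedLoxodromic_commute`).

The Bass–Serre tree is replaced by syllable length in an amalgamated product: it gives a
`0`-hyperbolic integral pseudometric on the group, whose tight span is a geodesic hyperbolic space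
(`isGeneralizedLoxodromic_of_length`). The splitting of `J` is replaced by an embedding of `J` in an
amalgam of two copies of itself (`Dunwoody.toDouble_injective`).

Finite generation: `G 1` and `H` suffice, since `z i` and its conjugates under `Hfin (i + 1)`
generate `Vfin (i + 1)` (`Dunwoody.Vfin_succ_le`). -/

/-! ### The tight span of a pseudometric space -/

/-- The tight span of a pseudometric space `Y`: the minimal functions `f` on `Y` with
`dist x y ≤ f x + f y`. -/
@[ext]
structure TightSpan (Y : Type*) [PseudoMetricSpace Y] where
  /-- The underlying function. -/
  toFun : Y → ℝ
  dist_le_add' : ∀ x y, dist x y ≤ toFun x + toFun y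
  exists_add_le' : ∀ x, ∀ η > 0, ∃ y, toFun x + toFun y ≤ dist x y + η

namespace TightSpan

variable {Y : Type*} [PseudoMetricSpace Y]

instance : CoeFun (TightSpan Y) fun _ => Y → ℝ := ⟨toFun⟩

theorem dist_le_add (f : TightSpan Y) (x y : Y) : dist x y ≤ f x + f y := f.dist_le_add' x y

theorem exists_add_le (f : TightSpan Y) (x : Y) {η : ℝ} (hη : 0 < η) :
    ∃ y, f x + f y ≤ dist x y + η := f.exists_add_le' x η hη

theorem nonneg (f : TightSpan Y) (x : Y) : 0 ≤ f x := by
  have := f.dist_le_add x x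
  rw [dist_self] at this
  linarith

theorem le_dist_add (f : TightSpan Y) (x y : Y) : f x ≤ dist x y + f y := by
  refine le_of_forall_pos_le_add fun η hη => ?_
  obtain ⟨t, ht⟩ := f.exists_add_le x hη
  linarith [f.dist_le_add y t, dist_triangle x y t]

theorem abs_sub_le_add (f g : TightSpan Y) (x y : Y) : |f x - g x| ≤ f y + g y := by
  rw [abs_le]
  constructor <;>
  linarith [f.le_dist_add x y, g.le_dist_add x y, f.dist_le_add x y, g.dist_le_add x y]

theorem bddAbove (f g : TightSpan Y) : BddAbove (Set.range fun x => |f x - g x|) := by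
  rcases isEmpty_or_nonempty Y with h | ⟨⟨y⟩⟩
  · simp [Set.range_eq_empty]
  · exact ⟨f y + g y, by rintro _ ⟨x, rfl⟩; exact abs_sub_le_add f g x y⟩

noncomputable instance : Dist (TightSpan Y) := ⟨fun f g => ⨆ x, |f x - g x|⟩

theorem abs_sub_le_dist (f g : TightSpan Y) (x : Y) : |f x - g x| ≤ dist f g :=
  le_ciSup (bddAbove f g) x

theorem dist_le {f g : TightSpan Y} {C : ℝ} (hC : 0 ≤ C) (h : ∀ x, |f x - g x| ≤ C) :
    dist f g ≤ C := Real.iSup_le h hC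

theorem dist_nonneg' (f g : TightSpan Y) : 0 ≤ dist f g :=
  Real.iSup_nonneg fun _ => abs_nonneg _

noncomputable instance : MetricSpace (TightSpan Y) where
  dist_self f := le_antisymm (dist_le le_rfl fun x => by simp) (dist_nonneg' f f)
  dist_comm f g := iSup_congr fun x => abs_sub_comm _ _
  dist_triangle f g h := dist_le (add_nonneg (dist_nonneg' f g) (dist_nonneg' g h)) fun x =>
    (abs_sub_le _ (g x) _).trans (add_le_add (abs_sub_le_dist f g x) (abs_sub_le_dist g h x))
  eq_of_dist_eq_zero {f g} h := TightSpan.ext <| funext fun x => by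
    have := abs_sub_le_dist f g x
    rw [h] at this
    exact sub_eq_zero.1 (abs_nonpos_iff.1 this)

theorem le_add_dist (f g : TightSpan Y) (x : Y) : f x ≤ g x + dist f g := by
  linarith [(abs_le.1 (abs_sub_le_dist f g x)).2]

/-- Minimality removes the absolute value: if `f - g` is very negative at `x`, it is very positive
at a point `y` where `g x + g y` is almost `dist x y`. -/
theorem exists_dist_le [Nonempty Y] (f g : TightSpan Y) {η : ℝ} (hη : 0 < η) :
    ∃ x, dist f g ≤ f x - g x + η := by
  obtain ⟨x, hx⟩ := exists_lt_of_lt_ciSup (show dist f g - η / 2 < ⨆ x, |f x - g x| by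
    change dist f g - η / 2 < dist f g; linarith)
  rcases le_total 0 (f x - g x) with h | h
  · rw [abs_of_nonneg h] at hx
    exact ⟨x, by linarith⟩
  · rw [abs_of_nonpos h] at hx
    obtain ⟨y, hy⟩ := g.exists_add_le x (half_pos hη)
    exact ⟨y, by linarith [f.dist_le_add x y]⟩

/-- With `dist_sub_le_dist`, this writes `dist f g` as a supremum of `dist x y - f x - g y`, so that
inequalities between sums of distances pass from `Y` to the tight span. -/
theorem exists_dist_le_dist_sub [Nonempty Y] (f g : TightSpan Y) {η : ℝ} (hη : 0 < η) :
    ∃ x y, dist f g ≤ dist x y - f x - g y + η := by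
  obtain ⟨y, hy⟩ := exists_dist_le f g (half_pos hη)
  obtain ⟨x, hx⟩ := f.exists_add_le y (half_pos hη)
  exact ⟨x, y, by rw [dist_comm x y]; linarith⟩

theorem dist_sub_le_dist (f g : TightSpan Y) (x y : Y) : dist x y - f x - g y ≤ dist f g := by
  linarith [f.dist_le_add x y, f.le_add_dist g y]

/-- The distance functions of the points of `Y`. -/
def of (y : Y) : TightSpan Y :=
  ⟨fun x => dist x y, fun a b => dist_triangle_right a b y, fun x η hη => ⟨y, by
    simpa using hη.le⟩⟩

theorem of_apply (x y : Y) : of y x = dist x y := rfl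

theorem dist_of (f : TightSpan Y) (y : Y) : dist f (of y) = f y := by
  refine le_antisymm (dist_le (f.nonneg y) fun x => ?_) ?_
  · rw [abs_le, of_apply]
    constructor <;> linarith [f.le_dist_add x y, f.dist_le_add x y]
  · simpa [of_apply, abs_of_nonneg (f.nonneg y)] using abs_sub_le_dist f (of y) y

theorem dist_of_of (x y : Y) : dist (of x) (of y) = dist x y := by
  rw [dist_of, of_apply, dist_comm]

end TightSpan

/-- The four point condition for `0`-hyperbolic spaces. -/
def FourPoint (Y : Type*) [PseudoMetricSpace Y] : Prop :=
  ∀ a b c d : Y, dist a b + dist c d ≤ max (dist a c + dist b d) (dist a d + dist b c)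

namespace TightSpan

variable {Y : Type*} [PseudoMetricSpace Y]

theorem fourPoint [Nonempty Y] (hY : FourPoint Y) : FourPoint (TightSpan Y) := by
  intro a b c d
  refine le_of_forall_pos_le_add fun η hη => ?_
  obtain ⟨x, y, h1⟩ := exists_dist_le_dist_sub a b (half_pos hη)
  obtain ⟨z, t, h2⟩ := exists_dist_le_dist_sub c d (half_pos hη)
  have h3 := dist_sub_le_dist a c x z
  have h4 := dist_sub_le_dist b d y t
  have h5 := dist_sub_le_dist a d x t
  have h6 := dist_sub_le_dist b c y z
  rcases le_max_iff.1 (hY x y z t) with h | h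
  · have := le_max_left (dist a c + dist b d) (dist a d + dist b c)
    linarith
  · have := le_max_right (dist a c + dist b d) (dist a d + dist b c)
    linarith

theorem four_point_apply [Nonempty Y] (hY : FourPoint Y) (f g : TightSpan Y) (x y : Y) :
    dist f g + dist x y ≤ max (f x + g y) (f y + g x) := by
  have := fourPoint hY f g (of x) (of y)
  rwa [dist_of_of, dist_of, dist_of, dist_of, dist_of] at this

theorem four_point_apply' [Nonempty Y] (hY : FourPoint Y) (f g : TightSpan Y) (x y : Y) :
    f x + g y ≤ max (dist f g + dist x y) (f y + g x) := by
  have := fourPoint hY f (of x) g (of y)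
  rwa [dist_of, dist_of, dist_of_of, dist_of, dist_comm (of x) g, dist_of] at this

/-- This is minimality of the function `segment` at points `x` where the term from `f` dominates.
The witness `y` lies behind `f` as seen from `g`, and the four point condition then makes `dist x y`
large. -/
theorem segment_apply_le [Nonempty Y] (hY : FourPoint Y) (f g : TightSpan Y) {t : ℝ} (h0 : 0 ≤ t)
    (h1 : t ≤ dist f g) {x : Y} (hx : g x - (dist f g - t) ≤ f x - t) {η : ℝ} (hη : 0 < η) :
    ∃ y, f x - t + max (f y - t) (g y - (dist f g - t)) ≤ dist x y + η := by
  rcases h0.eq_or_lt with rfl | h0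
  · obtain ⟨y, hy⟩ := f.exists_add_le x hη
    refine ⟨y, ?_⟩
    rw [max_eq_left (by rw [dist_comm]; linarith [g.le_add_dist f y])]
    linarith
  -- The error `η` is the one allowed in the claim; the error `t` excludes the second alternative of
  -- the four point condition.
  · obtain ⟨y, hy⟩ := exists_dist_le g f (lt_min hη h0)
    have e1 := min_le_left η t
    have e2 := min_le_right η t
    rw [dist_comm] at hy
    refine ⟨y, ?_⟩
    have h3 : f x + g y ≤ dist f g + dist x y := by
      rcases le_max_iff.1 (four_point_apply' hY f g x y) with h | h
      · exact h
      · linarith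
    rcases max_cases (f y - t) (g y - (dist f g - t)) with ⟨h, -⟩ | ⟨h, -⟩ <;> rw [h] <;> linarith

/-- The points of the segment from `f` to `g`, when `Y` is `0`-hyperbolic. -/
noncomputable def segment [Nonempty Y] (hY : FourPoint Y) (f g : TightSpan Y) (t : ℝ)
    (h0 : 0 ≤ t) (h1 : t ≤ dist f g) : TightSpan Y :=
  ⟨fun x => max (f x - t) (g x - (dist f g - t)), by
    intro x y
    have h := four_point_apply hY f g x y
    have := le_max_left (f x - t) (g x - (dist f g - t))
    have := le_max_right (f x - t) (g x - (dist f g - t))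
    have := le_max_left (f y - t) (g y - (dist f g - t))
    have := le_max_right (f y - t) (g y - (dist f g - t))
    rcases le_max_iff.1 h with h | h <;> linarith, by
    intro x η hη
    rcases le_total (g x - (dist f g - t)) (f x - t) with h | h
    · rw [max_eq_left h]
      exact segment_apply_le hY f g h0 h1 h hη
    · rw [max_eq_right h]
      obtain ⟨y, hy⟩ := segment_apply_le hY g f (t := dist f g - t) (by linarith)
        (by rw [dist_comm g f]; linarith) (x := x) (by rw [dist_comm g f]; linarith) hη
      refine ⟨y, ?_⟩
      rwa [dist_comm g f, sub_sub_cancel, max_comm] at hy⟩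

theorem isGeodesicSpace [Nonempty Y] (hY : FourPoint Y) : IsGeodesicSpace (TightSpan Y) := by
  intro f g
  let γ : ℝ → TightSpan Y := fun t =>
    if h : 0 ≤ t ∧ t ≤ dist f g then segment hY f g t h.1 h.2 else f
  have hγ : ∀ t (_ : 0 ≤ t) (_ : t ≤ dist f g) (x : Y),
      γ t x = max (f x - t) (g x - (dist f g - t)) := by
    intro t h h' x
    simp only [γ, dif_pos (And.intro h h')]
    rfl
  have e0 : γ 0 = f := TightSpan.ext <| funext fun x => by
    rw [hγ 0 le_rfl dist_nonneg, max_eq_left, sub_zero]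
    rw [dist_comm]; linarith [g.le_add_dist f x]
  have e1 : γ (dist f g) = g := TightSpan.ext <| funext fun x => by
    rw [hγ _ dist_nonneg le_rfl, max_eq_right, sub_self, sub_zero]
    linarith [f.le_add_dist g x]
  have hle : ∀ s ∈ Set.Icc 0 (dist f g), ∀ t ∈ Set.Icc 0 (dist f g), s ≤ t →
      dist (γ s) (γ t) ≤ t - s := by
    intro s hs t ht hst
    refine dist_le (by linarith) fun x => ?_
    rw [hγ s hs.1 hs.2, hγ t ht.1 ht.2]
    refine (abs_max_sub_max_le_max _ _ _ _).trans (max_le ?_ ?_) <;> rw [abs_le] <;>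
      constructor <;> linarith
  have heq : ∀ s ∈ Set.Icc 0 (dist f g), ∀ t ∈ Set.Icc 0 (dist f g), s ≤ t →
      dist (γ s) (γ t) = t - s := by
    intro s hs t ht hst
    refine le_antisymm (hle s hs t ht hst) ?_
    -- The upper bounds on the three pieces of the path add up to `dist f g`, so none of them can be
    -- strict.
    have h1 := hle 0 ⟨le_rfl, dist_nonneg⟩ s hs hs.1
    have h2 := hle t ht _ ⟨dist_nonneg, le_rfl⟩ ht.2
    rw [e0] at h1
    rw [e1] at h2
    linarith [dist_triangle4 f (γ s) (γ t) g]
  refine ⟨γ, e0, e1, fun s hs t ht => ?_⟩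
  rcases le_total s t with h | h
  · rw [heq s hs t ht h, abs_of_nonpos (by linarith)]; ring
  · rw [dist_comm, heq t ht s hs h, abs_of_nonneg (by linarith)]

theorem isHyperbolicSpace [Nonempty Y] (hY : FourPoint Y) : IsHyperbolicSpace (TightSpan Y) where
  nonempty := ⟨of (Classical.arbitrary Y)⟩
  geodesic := isGeodesicSpace hY
  hyperbolic := by
    refine ⟨0, le_rfl, fun w x y z => ?_⟩
    have h := fourPoint hY x z y w
    unfold gromovProduct
    rw [dist_comm z y] at h
    rcases le_max_iff.1 h with h | h
    · have := min_le_left ((dist x w + dist y w - dist x y) / 2) ((dist y w + dist z w - dist y z) / 2)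
      linarith
    · have := min_le_right ((dist x w + dist y w - dist x y) / 2) ((dist y w + dist z w - dist y z) / 2)
      linarith

/-- If `Y` is `0`-hyperbolic and roughly geodesic, then it is coarsely dense in its tight span. -/
theorem exists_apply_le_two [Nonempty Y] (hY : FourPoint Y)
    (hgeo : ∀ x y : Y, ∀ t : ℝ, 0 ≤ t → t ≤ dist x y →
      ∃ p, dist x p ≤ t + 1 ∧ dist p y ≤ dist x y - t + 1)
    (f : TightSpan Y) : ∃ y, f y ≤ 2 := by
  obtain ⟨x⟩ := ‹Nonempty Y›
  obtain ⟨y, hy⟩ := f.exists_add_le x one_pos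
  -- Since `f` is almost on a segment from `x` to `y`, the point at distance about `f x` from `x` is
  -- close to it; the minimum keeps the parameter in range.
  obtain ⟨p, hp, hp'⟩ := hgeo x y (min (f x) (dist x y)) (le_min (f.nonneg x) dist_nonneg)
    (min_le_right _ _)
  have h1 := min_le_left (f x) (dist x y)
  have h2 : dist x y - f y ≤ min (f x) (dist x y) :=
    le_min (by linarith [f.dist_le_add x y]) (by linarith [f.nonneg y])
  have : Nonempty Y := ⟨x⟩
  have h := four_point_apply hY f (of p) x y
  rw [dist_of, of_apply, of_apply, dist_comm y p] at h
  refine ⟨p, ?_⟩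
  rcases le_max_iff.1 h with h | h <;> linarith

section Action

variable {G : Type*} [Group G] [MulAction G Y] [IsIsometricSMul G Y]

instance : SMul G (TightSpan Y) where
  smul g f := ⟨fun x => f (g⁻¹ • x), fun x y => by
    rw [← dist_smul g⁻¹ x y]; exact f.dist_le_add _ _, fun x η hη => by
    obtain ⟨y, hy⟩ := f.exists_add_le (g⁻¹ • x) hη
    refine ⟨g • y, ?_⟩
    rw [inv_smul_smul, ← dist_smul g⁻¹ x, inv_smul_smul]
    exact hy⟩

theorem smul_apply (g : G) (f : TightSpan Y) (x : Y) : (g • f) x = f (g⁻¹ • x) := rfl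

instance : MulAction G (TightSpan Y) where
  one_smul f := TightSpan.ext <| funext fun x => by
    rw [smul_apply, inv_one, one_smul]
  mul_smul g h f := TightSpan.ext <| funext fun x => by
    rw [smul_apply, smul_apply, smul_apply, mul_inv_rev, mul_smul]

instance : IsIsometricSMul G (TightSpan Y) := by
  have key : ∀ (g : G) (f f' : TightSpan Y), dist (g • f) (g • f') ≤ dist f f' :=
    fun g f f' => dist_le dist_nonneg fun x => abs_sub_le_dist f f' (g⁻¹ • x)
  refine ⟨fun g => Isometry.of_dist_eq fun f f' => le_antisymm (key g f f') ?_⟩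
  simpa using key g⁻¹ (g • f) (g • f')

theorem smul_of (g : G) (y : Y) : g • of y = of (g • y) :=
  TightSpan.ext <| funext fun x => by
    rw [smul_apply, of_apply, of_apply, ← dist_smul g, smul_inv_smul]

end Action

end TightSpan

/-! ### Acylindrical actions from integral tree-like metrics -/

section Acylindrical

variable {Y : Type*} [PseudoMetricSpace Y] {G : Type*} [Group G] [MulAction G Y]
  [IsIsometricSMul G Y]

/-- In a tree, moving both ends of a segment by at most `ε` only changes it within `ε` of its ends.
-/
theorem FourPoint.between_of_small_displacement (hY : FourPoint Y) {x y x' y' q : Y} {ε : ℝ}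
    (hx : dist x x' ≤ ε) (hy : dist y y' ≤ ε) (h1 : ε < dist x' q) (h2 : ε < dist q y')
    (hq : dist x' q + dist q y' = dist x' y') :
    dist x q + dist q y = dist x y := by
  refine le_antisymm ?_ (dist_triangle x q y)
  have a1 : dist x q + dist q y' ≤ dist x y' := by
    have h := hY x q x' y'
    rw [dist_comm q x'] at h
    rcases le_max_iff.1 h with h | h
    · linarith [dist_triangle x' x q, dist_comm x x']
    · linarith
  have h := hY q y x y'
  rw [dist_comm q x, dist_comm y x] at h
  rcases le_max_iff.1 h with h | h
  · linarith [dist_triangle q y y', dist_nonneg (x := q) (y := y)]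
  · linarith

/-- A group acting on a `0`-hyperbolic space with integral distances, with discrete segments
between any two points and with uniformly finite stabilizers, acts acylindrically. -/
theorem FourPoint.exists_encard_le (hY : FourPoint Y) (hN : ∀ x y : Y, ∃ n : ℕ, dist x y = n)
    (hgeo : ∀ (x y : Y) (j : ℕ), (j : ℝ) ≤ dist x y →
      ∃ p, dist x p = j ∧ dist p y = dist x y - j)
    {k : ℕ} (hk : ∀ x : Y, {g : G | dist x (g • x) = 0}.encard ≤ k) (ε : ℝ) :
    ∃ (M : ℝ) (N : ℕ), 0 ≤ M ∧ ∀ x y : Y, M ≤ dist x y →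
      {g : G | dist x (g • x) ≤ ε ∧ dist y (g • y) ≤ ε}.encard ≤ N := by
  obtain ⟨j, hj⟩ := exists_nat_gt ε
  -- A point `p` at distance `j > ε` from `x` is also at least `j` from `y`, so its translates stay
  -- on the segment. Their distance from `x` is an integer in `[0, 2 * j]`, and each value is
  -- attained by at most `k` elements.
  refine ⟨2 * j, (2 * j + 1) * k, by positivity, fun x y hxy => ?_⟩
  have hj0 : (0 : ℝ) ≤ j := j.cast_nonneg
  obtain ⟨p, hp, hp'⟩ := hgeo x y j (by linarith)
  set S := {g : G | dist x (g • x) ≤ ε ∧ dist y (g • y) ≤ ε} with hS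
  have hbetween : ∀ g ∈ S, dist x (g • p) + dist (g • p) y = dist x y := fun g hg =>
    hY.between_of_small_displacement hg.1 hg.2 (by rw [dist_smul]; linarith)
      (by rw [dist_smul]; linarith) (by rw [dist_smul, dist_smul, dist_smul]; linarith)
  have hcover : S ⊆ ⋃ m ∈ Finset.range (2 * j + 1), {g ∈ S | dist x (g • p) = m} := by
    intro g hg
    obtain ⟨m, hm⟩ := hN x (g • p)
    simp only [Set.mem_iUnion]
    refine ⟨m, Finset.mem_range.2 ?_, hg, hm⟩
    have h := dist_triangle x (g • x) (g • p)
    rw [dist_smul, hm, hp] at h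
    have : (m : ℝ) < 2 * j + 1 := by linarith [hg.1]
    exact_mod_cast this
  have hpiece : ∀ m : ℕ, {g ∈ S | dist x (g • p) = m}.encard ≤ k := by
    intro m
    rcases Set.eq_empty_or_nonempty {g ∈ S | dist x (g • p) = m} with h | ⟨g₀, hg₀, hm₀⟩
    · rw [h]; simp
    · refine (Set.encard_le_encard_of_injOn (f := fun g => g₀⁻¹ * g) ?_
        (mul_right_injective _).injOn).trans (hk p)
      rintro g ⟨hg, hm⟩
      have b := hbetween g hg
      have b₀ := hbetween g₀ hg₀
      -- Two points of the segment at equal distance from `x` are at distance zero, so `g₀⁻¹ * g`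
      -- stabilizes `p`.
      have h := hY (g₀ • p) (g • p) x y
      rw [dist_comm (g₀ • p) x, dist_comm (g • p) x] at h
      have h0 : dist (g₀ • p) (g • p) ≤ 0 := by
        rcases le_max_iff.1 h with h | h <;> linarith
      change dist p ((g₀⁻¹ * g) • p) = 0
      rw [← dist_smul g₀, mul_smul, smul_inv_smul]
      exact le_antisymm h0 dist_nonneg
  calc S.encard ≤ _ := Set.encard_le_encard hcover
    _ ≤ ∑ m ∈ Finset.range (2 * j + 1), {g ∈ S | dist x (g • p) = m}.encard :=
        Finset.set_encard_biUnion_le _ _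
    _ ≤ ∑ _m ∈ Finset.range (2 * j + 1), (k : ℕ∞) := Finset.sum_le_sum fun m _ => hpiece m
    _ = _ := by simp

/-- Every point of the tight span is within `2` of `Y`, so passing to `Y` changes displacements and
distances by at most `4`. -/
theorem TightSpan.isAcylindricalAction [Nonempty Y] (hY : FourPoint Y)
    (hN : ∀ x y : Y, ∃ n : ℕ, dist x y = n)
    (hgeo : ∀ (x y : Y) (j : ℕ), (j : ℝ) ≤ dist x y →
      ∃ p, dist x p = j ∧ dist p y = dist x y - j)
    {k : ℕ} (hk : ∀ x : Y, {g : G | dist x (g • x) = 0}.encard ≤ k) :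
    IsAcylindricalAction G (TightSpan Y) := by
  intro ε _
  obtain ⟨M, N, hM, h⟩ := hY.exists_encard_le hN hgeo hk (ε + 4)
  have hdense : ∀ f : TightSpan Y, ∃ y, dist f (of y) ≤ 2 := by
    intro f
    simp only [dist_of]
    refine exists_apply_le_two hY (fun x y t h0 ht => ?_) f
    obtain ⟨p, hp, hp'⟩ := hgeo x y ⌊t⌋₊ ((Nat.floor_le h0).trans ht)
    exact ⟨p, by linarith [Nat.floor_le h0], by linarith [Nat.lt_floor_add_one t]⟩
  have hdisp : ∀ (f : TightSpan Y) (y : Y) (g : G), dist f (of y) ≤ 2 → dist f (g • f) ≤ ε →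
      dist y (g • y) ≤ ε + 4 := by
    intro f y g hy hg
    rw [← dist_of_of, ← smul_of]
    have := dist_triangle4 (of y) f (g • f) (g • of y)
    rw [dist_smul, dist_comm (of y) f] at this
    linarith
  refine ⟨M + 4, N, by linarith, fun f f' hff' => ?_⟩
  obtain ⟨y, hy⟩ := hdense f
  obtain ⟨y', hy'⟩ := hdense f'
  have hsub : {g : G | dist f (g • f) ≤ ε ∧ dist f' (g • f') ≤ ε} ⊆
      {g : G | dist y (g • y) ≤ ε + 4 ∧ dist y' (g • y') ≤ ε + 4} :=
    fun g hg => ⟨hdisp f y g hy hg.1, hdisp f' y' g hy' hg.2⟩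
  refine (Set.encard_le_encard hsub).trans (h y y' ?_)
  rw [← dist_of_of]
  linarith [dist_triangle4 f (of y) (of y') f', dist_comm f' (of y')]

end Acylindrical

/-- An element of a group is generalized loxodromic if its powers have length growing linearly for
some integral length function which is tree-like and vanishes only finitely often. -/
theorem isGeneralizedLoxodromic_of_length {P : Type w} [Group P] (l : P → ℕ) (h1 : l 1 = 0)
    (hinv : ∀ x, l x⁻¹ = l x)
    (h4 : ∀ x y z : P, l (x⁻¹ * y) + l z ≤ max (l (x⁻¹ * z) + l y) (l x + l (y⁻¹ * z)))
    (hfin : {x | l x = 0}.Finite)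
    (hpre : ∀ x, ∀ j ≤ l x, ∃ p, l p = j ∧ l (p⁻¹ * x) = l x - j)
    {g : P} (hg : ∀ n : ℕ, l (g ^ n) = 2 * n) : IsGeneralizedLoxodromic.{max v w} g := by
  have htri : ∀ x y, l (x⁻¹ * y) ≤ l x + l y := fun x y => by
    simpa [h1, hinv] using h4 x y 1
  have h4' : ∀ a b c d : P, l (a⁻¹ * b) + l (c⁻¹ * d) ≤
      max (l (a⁻¹ * c) + l (b⁻¹ * d)) (l (a⁻¹ * d) + l (b⁻¹ * c)) := by
    intro a b c d
    -- The hypothesis is the four point condition with one point at `1`; left translation gives the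
    -- general case.
    have h := h4 (d⁻¹ * a) (d⁻¹ * b) (d⁻¹ * c)
    have e : ∀ x y : P, l (y⁻¹ * x) = l (x⁻¹ * y) := fun x y => by
      rw [← hinv, mul_inv_rev, inv_inv]
    simp only [mul_inv_rev, inv_inv, mul_assoc, mul_inv_cancel_left] at h
    rwa [e c d, e a d, e b d] at h
  let _ : PseudoMetricSpace (ULift.{v} P) :=
    { dist := fun x y => (l (x.down⁻¹ * y.down) : ℝ)
      dist_self := fun x => by simp [h1]
      dist_comm := fun x y => by
        rw [← hinv, mul_inv_rev, inv_inv]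
      dist_triangle := fun x y z => by
        have := htri (x.down⁻¹ * y.down)⁻¹ (y.down⁻¹ * z.down)
        rw [inv_inv, hinv] at this
        have e : x.down⁻¹ * y.down * (y.down⁻¹ * z.down) = x.down⁻¹ * z.down := by group
        rw [e] at this
        exact_mod_cast this }
  have hd : ∀ x y : ULift.{v} P, dist x y = (l (x.down⁻¹ * y.down) : ℝ) := fun _ _ => rfl
  have : IsIsometricSMul P (ULift.{v} P) := ⟨fun g => Isometry.of_dist_eq fun x y => by
    rw [hd, hd]; simp [mul_assoc]⟩
  have hY : FourPoint (ULift.{v} P) := fun a b c d => by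
    have := h4' a.down b.down c.down d.down
    simp only [hd]
    exact_mod_cast this
  refine ⟨TightSpan (ULift.{v} P), inferInstance, inferInstance, inferInstance,
    TightSpan.isHyperbolicSpace hY,
    TightSpan.isAcylindricalAction hY (fun x y => ⟨_, hd x y⟩) ?_ (k := hfin.toFinset.card) ?_,
    TightSpan.of ⟨1⟩, 2, 0, one_le_two, le_rfl, fun m n => ?_⟩
  · intro x y j hj
    rw [hd] at hj
    have hj' : j ≤ l (x.down⁻¹ * y.down) := by exact_mod_cast hj
    obtain ⟨p, hp, hp'⟩ := hpre _ j hj'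
    refine ⟨⟨x.down * p⟩, ?_, ?_⟩
    · rw [hd]; simp [hp]
    · rw [hd, hd]
      simp only [mul_inv_rev, mul_assoc]
      rw [hp', Nat.cast_sub hj']
  · intro x
    rw [← Set.encard_coe_eq_coe_finsetCard, Set.Finite.coe_toFinset]
    refine Set.encard_le_encard_of_injOn (f := fun g => x.down⁻¹ * (g * x.down)) ?_ ?_
    · intro g hg
      have hg : dist x (g • x) = 0 := hg
      rw [hd] at hg
      exact_mod_cast hg
    · intro a _ b _ hab
      exact mul_right_cancel (mul_left_cancel hab)
  · have hz : ∀ n : ℤ, (l (g ^ n) : ℝ) = 2 * |(n : ℝ)| := by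
      intro n
      obtain ⟨k, rfl | rfl⟩ := n.eq_nat_or_neg
      · simp [hg]
      · simp [hg, hinv]
    have : dist (g ^ m • TightSpan.of (⟨1⟩ : ULift.{v} P)) (g ^ n • TightSpan.of ⟨1⟩) =
        2 * dist m n := by
      rw [TightSpan.smul_of, TightSpan.smul_of, TightSpan.dist_of_of, hd]
      have e : (g ^ m • (⟨1⟩ : ULift.{v} P)).down⁻¹ * (g ^ n • (⟨1⟩ : ULift.{v} P)).down =
          g ^ (n - m) := by
        simp [← zpow_neg, ← zpow_add, neg_add_eq_sub]
      rw [e, hz, Int.dist_eq, abs_sub_comm]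
      push_cast
      rfl
    rw [this]
    have := dist_nonneg (x := m) (y := n)
    constructor <;> linarith

/-! ### Syllable length in amalgamated products -/

namespace Monoid.PushoutI

open NormalWord

section Common

variable {ι : Type*} {G : ι → Type*}

open Classical in
/-- Twice the Gromov product of two lists, read as paths in a tree. -/
noncomputable def common : List (Σ i, G i) → List (Σ i, G i) → ℕ
  | a :: L, b :: L' => if a = b then 2 + common L L' else if a.1 = b.1 then 1 else 0
  | [], _ => 0
  | _ :: _, [] => 0

theorem common_comm (L L' : List (Σ i, G i)) : common L L' = common L' L := by
  induction L generalizing L' with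
  | nil => cases L' <;> simp [common]
  | cons a L ih =>
    cases L' with
    | nil => simp [common]
    | cons b L' =>
      simp only [common, ih L']
      split_ifs <;> simp_all

/-- Paths that follow `B` to some depth follow each other to that depth. The half step counted for
distinct letters of one factor respects this, as sharing a factor is transitive. -/
theorem min_common_le (A B C : List (Σ i, G i)) :
    min (common A B) (common B C) ≤ common A C := by
  induction A generalizing B C with
  | nil => simp [common]
  | cons a A ih =>
    cases B with
    | nil => simp [common]
    | cons b B =>
      cases C with
      | nil => simp [common]
      | cons c C =>
        have := ih B C
        simp only [common]
        by_cases hab : a = b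
        · subst hab
          split_ifs <;> omega
        · by_cases hbc : b = c
          · subst hbc
            split_ifs <;> omega
          · by_cases h1 : a.1 = b.1
            · by_cases h2 : b.1 = c.1
              · simp only [if_neg hab, if_neg hbc, if_pos h1, if_pos h2, if_pos (h1.trans h2)]
                split_ifs <;> omega
              · simp [if_neg hbc, if_neg h2]
            · simp [if_neg hab, if_neg h1]

end Common

variable {ι : Type*} {G : ι → Type*} {H : Type*} [∀ i, Group (G i)] [Group H]
  {φ : ∀ i, H →* G i}

/-- The product in the amalgamated product of a list of letters. -/
def listProd (φ : ∀ i, H →* G i) (L : List (Σ i, G i)) : PushoutI φ :=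
  (L.map fun a => of a.1 a.2).prod

@[simp]
theorem listProd_nil : listProd φ [] = 1 := rfl

@[simp]
theorem listProd_cons (a : Σ i, G i) (L : List (Σ i, G i)) :
    listProd φ (a :: L) = of a.1 a.2 * listProd φ L := by
  simp [listProd]

theorem listProd_append (L L' : List (Σ i, G i)) :
    listProd φ (L ++ L') = listProd φ L * listProd φ L' := by
  simp [listProd]

/-- The formal inverse of a list of letters. -/
def invList (L : List (Σ i, G i)) : List (Σ i, G i) :=
  (L.map fun a => ⟨a.1, a.2⁻¹⟩).reverse

theorem listProd_invList (L : List (Σ i, G i)) :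
    listProd φ (invList L) = (listProd φ L)⁻¹ := by
  induction L with
  | nil => simp [invList]
  | cons a L ih =>
    have : invList (a :: L) = invList L ++ [⟨a.1, a.2⁻¹⟩] := by simp [invList]
    rw [this, listProd_append, ih]
    simp

/-- A list of letters is reduced if adjacent letters belong to different factors and no letter
lies in the amalgamated subgroup. -/
def IsReducedList (φ : ∀ i, H →* G i) (L : List (Σ i, G i)) : Prop :=
  L.IsChain (fun a b => a.1 ≠ b.1) ∧ ∀ a ∈ L, a.2 ∉ (φ a.1).range

theorem IsReducedList.invList {L : List (Σ i, G i)} (h : IsReducedList φ L) :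
    IsReducedList φ (invList L) := by
  constructor
  · rw [PushoutI.invList, List.isChain_reverse, List.isChain_map]
    exact h.1.imp fun _ _ hab => hab.symm
  · intro a ha
    simp only [PushoutI.invList, List.mem_reverse, List.mem_map] at ha
    obtain ⟨b, hb, rfl⟩ := ha
    exact fun hn => h.2 b hb (inv_mem_iff.1 hn)

theorem isReducedList_reverse {L : List (Σ i, G i)} :
    IsReducedList φ L.reverse ↔ IsReducedList φ L := by
  simp only [IsReducedList, List.isChain_reverse, List.mem_reverse, ne_comm]

theorem isReducedList_cons {a : Σ i, G i} {L : List (Σ i, G i)} :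
    IsReducedList φ (a :: L) ↔
      (∀ b ∈ L.head?, a.1 ≠ b.1) ∧ a.2 ∉ (φ a.1).range ∧ IsReducedList φ L := by
  simp only [IsReducedList, List.isChain_cons, List.forall_mem_cons]
  tauto

theorem IsReducedList.reverse_append {L L' : List (Σ i, G i)} (h : IsReducedList φ L.reverse)
    (h' : IsReducedList φ L') (hne : ∀ a ∈ L.head?, ∀ b ∈ L'.head?, a.1 ≠ b.1) :
    IsReducedList φ (L.reverse ++ L') := by
  refine ⟨List.isChain_append.2 ⟨h.1, h'.1, by simpa using hne⟩, fun a ha => ?_⟩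
  rcases List.mem_append.1 ha with ha | ha
  exacts [h.2 a ha, h'.2 a ha]

variable (d : Transversal φ)

open Classical in
/-- The syllable length of an element of an amalgamated product. -/
noncomputable def len (x : PushoutI φ) : ℕ :=
  (NormalWord.equiv (d := d) x).toList.length

theorem len_prod (w : NormalWord d) : len d w.prod = w.toList.length := by
  classical
  rw [len, show w.prod = NormalWord.equiv.symm w from rfl, Equiv.apply_symm_apply]

theorem ofCoprodI_word_prod (w : CoprodI.Word G) :
    (ofCoprodI w.prod : PushoutI φ) = listProd φ w.toList := by
  simp [CoprodI.Word.prod, listProd, map_list_prod, Function.comp_def]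

theorem len_base_mul (h : H) (x : PushoutI φ) : len d (base φ h * x) = len d x := by
  classical
  obtain ⟨w, rfl⟩ := (NormalWord.equiv (d := d)).symm.surjective x
  change len d (base φ h * w.prod) = len d w.prod
  rw [← prod_base_smul, len_prod, len_prod]
  rfl

theorem len_listProd {L : List (Σ i, G i)} (hL : IsReducedList φ L) :
    len d (listProd φ L) = L.length := by
  let w : CoprodI.Word G :=
    ⟨L, fun a ha h1 => hL.2 a ha (h1 ▸ Subgroup.one_mem _), hL.1⟩
  obtain ⟨w', hw', hmap⟩ := Reduced.exists_normalWord_prod_eq (φ := φ) d (w := w) hL.2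
  rw [ofCoprodI_word_prod] at hw'
  rw [← show listProd φ w.toList = listProd φ L from rfl, ← hw', len_prod]
  simpa [w] using congrArg List.length hmap

/-- A normal list: a reduced list whose letters belong to the transversal. -/
def IsNormalList (L : List (Σ i, G i)) : Prop :=
  IsReducedList φ L ∧ ∀ a ∈ L, a.2 ∈ d.set a.1

theorem mem_transversal_unique {i : ι} {a b : G i} (ha : a ∈ d.set i) (hb : b ∈ d.set i)
    (h : a * b⁻¹ ∈ (φ i).range) : a = b := by
  have := (d.compl i).injective (a₁ := (⟨1, one_mem _⟩, ⟨a, ha⟩))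
    (a₂ := (⟨a * b⁻¹, h⟩, ⟨b, hb⟩)) (by simp)
  simpa using congrArg (fun p => (p.2 : G i)) this

/-- The list is stored in reverse: cancellation in `x * y⁻¹` occurs at the right ends of the normal
forms, which become the heads on which `common` recurses. -/
theorem exists_isNormalList (x : PushoutI φ) :
    ∃ (h : H) (L : List (Σ i, G i)), IsNormalList d L.reverse ∧ x = base φ h * listProd φ L.reverse
      ∧ len d x = L.length := by
  classical
  obtain ⟨w, rfl⟩ := (NormalWord.equiv (d := d)).symm.surjective x
  refine ⟨w.head, w.toList.reverse, ⟨⟨?_, ?_⟩, ?_⟩, ?_, ?_⟩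
  · simpa using w.chain_ne
  · rintro ⟨i, a⟩ ha hn
    rw [List.reverse_reverse] at ha
    refine w.ne_one _ ha (mem_transversal_unique d (w.normalized i a ha) (d.one_mem i) ?_)
    simpa using hn
  · intro a ha
    rw [List.reverse_reverse] at ha
    exact w.normalized a.1 a.2 ha
  · rw [List.reverse_reverse, ← ofCoprodI_word_prod]
    rfl
  · rw [List.length_reverse]
    exact len_prod d w

/-- Equal end letters cancel and cost two syllables. Distinct ones of the same factor merge into `a
* b⁻¹` and cost one; this letter is not in the amalgamated subgroup because `a` and `b` are
transversal elements. Letters of different factors cost nothing. -/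
theorem len_mul_inv_add_common {L L' : List (Σ i, G i)} (hL : IsNormalList d L.reverse)
    (hL' : IsNormalList d L'.reverse) :
    len d (listProd φ L.reverse * (listProd φ L'.reverse)⁻¹) + common L L' =
      L.length + L'.length := by
  have hred : ∀ A B : List (Σ i, G i), IsReducedList φ A.reverse → IsReducedList φ B.reverse →
      (∀ a ∈ A.head?, ∀ b ∈ B.head?, a.1 ≠ b.1) →
      len d (listProd φ A.reverse * (listProd φ B.reverse)⁻¹) = A.length + B.length := by
    intro A B hA hB hAB
    rw [← listProd_invList, ← listProd_append, len_listProd d (hA.reverse_append hB.invList ?_)]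
    · simp [invList]
    · intro a ha b hb
      simp only [invList, List.map_reverse, List.reverse_reverse, List.head?_map,
        Option.mem_map] at hb
      obtain ⟨c, hc, rfl⟩ := hb
      exact hAB a ha c hc
  induction L generalizing L' with
  | nil => simpa [common] using hred [] L' hL.1 hL'.1 (by simp)
  | cons a A ih =>
    cases L' with
    | nil => simpa [common] using hred (a :: A) [] hL.1 hL'.1 (by simp)
    | cons b B =>
      have hA := isReducedList_cons.1 (isReducedList_reverse.1 hL.1)
      have hB := isReducedList_cons.1 (isReducedList_reverse.1 hL'.1)
      have hA' : IsNormalList d A.reverse :=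
        ⟨isReducedList_reverse.2 hA.2.2, fun c hc => hL.2 c (by simp_all)⟩
      have hB' : IsNormalList d B.reverse :=
        ⟨isReducedList_reverse.2 hB.2.2, fun c hc => hL'.2 c (by simp_all)⟩
      by_cases hab : a = b
      · subst hab
        have := ih hA' hB'
        simp only [List.reverse_cons, listProd_append, mul_inv_rev, common, if_true,
          List.length_cons]
        rw [mul_assoc, mul_inv_cancel_left]
        omega
      · by_cases h1 : a.1 = b.1
        · obtain ⟨i, a⟩ := a
          obtain ⟨j, b⟩ := b
          obtain rfl : i = j := h1
          have hne : a * b⁻¹ ∉ (φ i).range := fun hn => hab <| congrArg (Sigma.mk i) <|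
            mem_transversal_unique d (hL.2 ⟨i, a⟩ (by simp)) (hL'.2 ⟨i, b⟩ (by simp)) hn
          have hM : IsReducedList φ ((⟨i, a * b⁻¹⟩ :: A).reverse) :=
            isReducedList_reverse.2 (isReducedList_cons.2 ⟨hA.1, hne, hA.2.2⟩)
          have := hred (⟨i, a * b⁻¹⟩ :: A) B hM hB'.1 (by simpa using hB.1)
          simp only [common, if_neg hab, if_true, List.reverse_cons, listProd_append,
            List.length_cons, mul_inv_rev] at this ⊢
          have e : listProd φ A.reverse * listProd φ [⟨i, a⟩] *
              ((listProd φ [⟨i, b⟩])⁻¹ * (listProd φ B.reverse)⁻¹) =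
              listProd φ A.reverse * listProd φ [⟨i, a * b⁻¹⟩] * (listProd φ B.reverse)⁻¹ := by
            simp [mul_assoc]
          rw [e, this]
          omega
        · rw [hred (a :: A) (b :: B) hL.1 hL'.1 (by simpa using h1)]
          simp [common, hab, h1]

theorem len_one : len d 1 = 0 :=
  len_listProd d (L := []) ⟨List.isChain_nil, by simp⟩

theorem len_mul_base (x : PushoutI φ) (h : H) : len d (x * base φ h) = len d x := by
  obtain ⟨h', L, hL, rfl, hlen⟩ := exists_isNormalList d x
  rw [hlen, mul_assoc, len_base_mul]
  cases L with
  | nil => simpa [len_listProd d (L := []) ⟨List.isChain_nil, by simp⟩] using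
    (len_base_mul d h 1).trans (len_one d)
  | cons a A =>
    obtain ⟨i, a⟩ := a
    have hA := isReducedList_cons.1 (isReducedList_reverse.1 hL.1)
    have hM : IsReducedList φ (⟨i, a * φ i h⟩ :: A) :=
      isReducedList_cons.2 ⟨hA.1, fun hn => hA.2.1 <| by
        simpa using (φ i).range.mul_mem hn ((φ i).range.inv_mem ⟨h, rfl⟩), hA.2.2⟩
    have := len_listProd d (isReducedList_reverse.2 hM)
    rw [List.reverse_cons, listProd_append] at this ⊢
    rw [← of_apply_eq_base φ i]
    simpa [mul_assoc] using this

/-- The base parts of the normal forms of `x` and `y` end up at the two ends of `x * y⁻¹`, where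
they do not affect the length. -/
theorem exists_path : ∃ c : PushoutI φ → List (Σ i, G i), ∀ x y,
    len d (x * y⁻¹) + common (c x) (c y) = len d x + len d y := by
  choose h c hc hx hlen using exists_isNormalList d
  refine ⟨c, fun x y => ?_⟩
  rw [hlen x, hlen y, ← len_mul_inv_add_common d (hc x) (hc y)]
  congr 1
  conv_lhs => rw [hx x, hx y]
  rw [mul_inv_rev, ← map_inv, mul_assoc, len_base_mul, ← mul_assoc, len_mul_base]

theorem len_inv (x : PushoutI φ) : len d x⁻¹ = len d x := by
  obtain ⟨c, hc⟩ := exists_path d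
  have h1 := hc 1 x
  have h2 := hc x 1
  simp only [common_comm (c 1), len_one, one_mul, inv_one, mul_one] at h1 h2
  omega

/-- The tree-like inequality for the syllable length. -/
theorem len_four_point (x y z : PushoutI φ) : len d (x⁻¹ * y) + len d z ≤
    max (len d (x⁻¹ * z) + len d y) (len d x + len d (y⁻¹ * z)) := by
  obtain ⟨c, hc⟩ := exists_path d
  have hxy := hc x⁻¹ y⁻¹
  have hxz := hc x⁻¹ z⁻¹
  have hyz := hc y⁻¹ z⁻¹
  have h := min_common_le (c x⁻¹) (c z⁻¹) (c y⁻¹)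
  rw [common_comm (c z⁻¹)] at h
  simp only [inv_inv, len_inv] at hxy hxz hyz
  omega

theorem mem_range_base_of_len_eq_zero {x : PushoutI φ} (hx : len d x = 0) :
    x ∈ (base φ).range := by
  obtain ⟨h, L, -, rfl, hlen⟩ := exists_isNormalList d x
  rw [hx] at hlen
  rw [List.length_eq_zero_iff.1 hlen.symm]
  exact ⟨h, by simp⟩

/-- These are the discrete segments of the metric, obtained by cutting the normal form of `x⁻¹`.
With `x⁻¹`, the base element stays at the left end of the remaining piece, where the length ignores
it. -/
theorem exists_prefix (x : PushoutI φ) {j : ℕ} (hj : j ≤ len d x) :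
    ∃ p, len d p = j ∧ len d (p⁻¹ * x) = len d x - j := by
  obtain ⟨h, L, hL, hx, hlen⟩ := exists_isNormalList d x⁻¹
  rw [len_inv] at hlen
  rw [hlen] at hj ⊢
  have hL := isReducedList_reverse.1 hL.1
  have hsub : ∀ A : List (Σ i, G i), A <:+: L → IsReducedList φ A.reverse := fun A hA =>
    isReducedList_reverse.2 ⟨hL.1.infix hA, fun a ha => hL.2 a (hA.subset ha)⟩
  refine ⟨(listProd φ (L.take j).reverse)⁻¹, ?_, ?_⟩
  · rw [len_inv, len_listProd d (hsub _ (List.take_prefix j L).isInfix)]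
    simpa using hj
  · rw [← len_inv, mul_inv_rev, hx, inv_inv]
    have e : listProd φ L.reverse =
        listProd φ (L.drop j).reverse * listProd φ (L.take j).reverse := by
      rw [← listProd_append, ← List.reverse_append, List.take_append_drop]
    rw [e, mul_assoc, mul_inv_cancel_right, len_base_mul,
      len_listProd d (hsub _ (List.drop_suffix j L).isInfix)]
    simp

theorem len_pow_of_mul_of {i j : ι} (hij : i ≠ j) {a : G i} (ha : a ∉ (φ i).range) {b : G j}
    (hb : b ∉ (φ j).range) (n : ℕ) : len d ((of i a * of j b : PushoutI φ) ^ n) = 2 * n := by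
  have key : ∃ L : List (Σ i, G i), IsReducedList φ L ∧ (∀ c ∈ L.head?, c.1 = i) ∧
      listProd φ L = (of i a * of j b) ^ n ∧ L.length = 2 * n := by
    induction n with
    | zero => exact ⟨[], ⟨List.isChain_nil, by simp⟩, by simp, rfl, rfl⟩
    | succ n ih =>
      obtain ⟨L, hL, hhead, hprod, hlen⟩ := ih
      refine ⟨⟨i, a⟩ :: ⟨j, b⟩ :: L, ?_, by simp, ?_, by simp [hlen]; ring⟩
      · rw [isReducedList_cons, isReducedList_cons]
        exact ⟨by simpa using hij, ha, fun c hc => (hhead c hc).symm ▸ hij.symm, hb, hL⟩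
      · rw [listProd_cons, listProd_cons, hprod, pow_succ', mul_assoc]
  obtain ⟨L, hL, -, hprod, hlen⟩ := key
  rw [← hprod, len_listProd d hL, hlen]

universe a b c

/-- In an amalgamated product over a finite group, the product of two elements of different factors
outside the amalgamated subgroup is generalized loxodromic. -/
theorem isGeneralizedLoxodromic_of_mul_of {ι : Type a} {G : ι → Type b} {H : Type c}
    [∀ i, Group (G i)] [Group H] [Finite H] {φ : ∀ i, H →* G i}
    (hφ : ∀ i, Function.Injective (φ i))
    {i j : ι} (hij : i ≠ j) {x : G i} (hx : x ∉ (φ i).range) {y : G j} (hy : y ∉ (φ j).range) :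
    IsGeneralizedLoxodromic.{max v a b c} (of i x * of j y : PushoutI φ) := by
  obtain ⟨d⟩ := transversal_nonempty φ hφ
  exact isGeneralizedLoxodromic_of_length (len d) (len_one d) (len_inv d) (len_four_point d)
    ((Set.finite_range (base φ)).subset fun x hx => mem_range_base_of_len_eq_zero d hx)
    (fun x j hj => exists_prefix d x hj) (len_pow_of_mul_of d hij hx hy)

end Monoid.PushoutI

/-- Generalized loxodromic elements pull back along injective homomorphisms. -/
theorem IsGeneralizedLoxodromic.of_injective {G : Type w} {P : Type*} [Group G] [Group P]
    {f : G →* P} (hf : Function.Injective f) {g : G}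
    (h : IsGeneralizedLoxodromic.{v} (f g)) : IsGeneralizedLoxodromic.{v} g := by
  obtain ⟨X, _, _, hiso, hhyp, hac, x, hx⟩ := h
  let _ : MulAction G X := MulAction.compHom X f
  have hsmul : ∀ (a : G) (y : X), a • y = f a • y := fun _ _ => rfl
  refine ⟨X, inferInstance, inferInstance, ⟨fun a => isometry_smul X (f a)⟩, hhyp, ?_, x, ?_⟩
  · intro ε hε
    obtain ⟨M, N, hM, h⟩ := hac ε hε
    refine ⟨M, N, hM, fun y z hyz => le_trans ?_ (h y z hyz)⟩
    exact Set.encard_le_encard_of_injOn (f := f) (fun a ha => ha) hf.injOn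
  · simpa only [hsmul, map_zpow] using hx

/-! ### Finite groups acting on hyperbolic spaces -/

theorem IsHyperbolicSpace.exists_four_point {X : Type*} [MetricSpace X]
    (hX : IsHyperbolicSpace X) : ∃ δ : ℝ, 0 ≤ δ ∧ ∀ a b c d : X,
      dist a b + dist c d ≤ max (dist a c + dist b d) (dist a d + dist b c) + 2 * δ := by
  obtain ⟨δ, hδ, h⟩ := hX.hyperbolic
  refine ⟨δ, hδ, fun a b c d => ?_⟩
  have h := h d a c b
  unfold gromovProduct at h
  rw [dist_comm c b] at h
  have h1 := le_max_left (dist a c + dist b d) (dist a d + dist b c)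
  have h2 := le_max_right (dist a c + dist b d) (dist a d + dist b c)
  rcases min_le_iff.1 (sub_le_iff_le_add.1 h) with h | h <;> linarith

/-- Finite groups of isometries of a hyperbolic space have almost fixed points. -/
theorem IsHyperbolicSpace.exists_almost_fixed {G : Type*} {X : Type*} [Group G] [MetricSpace X]
    [MulAction G X] [IsIsometricSMul G X] (hX : IsHyperbolicSpace X) :
    ∃ C : ℝ, 0 < C ∧ ∀ F : Subgroup G, Finite F → ∃ x : X, ∀ h ∈ F, dist x (h • x) ≤ C := by
  obtain ⟨δ, hδ, h4⟩ := hX.exists_four_point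
  refine ⟨4 * δ + 2, by linarith, fun F _ => ?_⟩
  obtain ⟨x₀⟩ := hX.nonempty
  -- `r x` is the radius of the orbit of `x₀` seen from `x`. A near-minimizer is an approximate
  -- centre, and `F` permutes approximate centres.
  let r : X → ℝ := fun x => ⨆ h : F, dist x ((h : G) • x₀)
  have hle : ∀ (x : X) (h : F), dist x ((h : G) • x₀) ≤ r x := fun x h =>
    le_ciSup (f := fun h : F => dist x ((h : G) • x₀)) (Set.finite_range _).bddAbove h
  have hr0 : ∀ x, 0 ≤ r x := fun x => Real.iSup_nonneg fun _ => dist_nonneg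
  have hbdd : BddBelow (Set.range r) := ⟨0, by rintro _ ⟨x, rfl⟩; exact hr0 x⟩
  have : Nonempty X := ⟨x₀⟩
  obtain ⟨x, hx⟩ := exists_lt_of_ciInf_lt (show ⨅ x, r x < (⨅ x, r x) + 1 by linarith)
  refine ⟨x, fun h hh => ?_⟩
  obtain ⟨γ, hγ0, hγ1, hγ⟩ := hX.geodesic x (h • x)
  set D := dist x (h • x) with hD
  have hD0 : 0 ≤ D := dist_nonneg
  have e1 : dist (γ (D / 2)) x = D / 2 := by
    rw [← hγ0, hγ _ ⟨by linarith, by linarith⟩ _ ⟨le_rfl, hD0⟩, abs_of_nonneg (by linarith)]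
    ring
  have e2 : dist (γ (D / 2)) (h • x) = D / 2 := by
    rw [← hγ1, hγ _ ⟨by linarith, by linarith⟩ _ ⟨hD0, le_rfl⟩, abs_of_nonpos (by linarith)]
    ring
  -- The midpoint of two centres sees a smaller radius unless they are close; near-minimality up to
  -- `1` gives `D ≤ 4 * δ + 2`.
  have hm : r (γ (D / 2)) ≤ r x - D / 2 + 2 * δ := by
    refine ciSup_le fun k => ?_
    have a1 : dist x ((k : G) • x₀) ≤ r x := hle x k
    have a2 : dist (h • x) ((k : G) • x₀) ≤ r x := by
      have := hle x (⟨h, hh⟩⁻¹ * k)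
      rwa [Subgroup.coe_mul, mul_smul, Subgroup.coe_inv, ← dist_smul h, smul_inv_smul] at this
    have := h4 (γ (D / 2)) ((k : G) • x₀) x (h • x)
    rw [e1, e2, dist_comm ((k : G) • x₀) x, dist_comm ((k : G) • x₀) (h • x)] at this
    rcases max_cases (D / 2 + dist (h • x) ((k : G) • x₀)) (D / 2 + dist x ((k : G) • x₀)) with
      ⟨h, -⟩ | ⟨h, -⟩ <;> rw [h] at this <;> linarith
  linarith [ciInf_le hbdd (γ (D / 2))]

/-- For an acylindrical action on a hyperbolic space, an element which commutes with sufficiently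
many elements of a finite subgroup is not loxodromic. -/
theorem IsAcylindricalAction.exists_not_isLoxodromic {G : Type*} {X : Type*} [Group G]
    [MetricSpace X] [MulAction G X] [IsIsometricSMul G X] (hX : IsHyperbolicSpace X)
    (hac : IsAcylindricalAction G X) : ∃ N : ℕ, ∀ (F : Subgroup G) (g : G), Finite F →
      (N : ℕ∞) < {h | h ∈ F ∧ Commute h g}.encard → ¬ IsLoxodromic X g := by
  obtain ⟨C, hC, hF⟩ := hX.exists_almost_fixed (G := G)
  obtain ⟨M, N, hM, hN⟩ := hac C hC
  refine ⟨N, fun F g hFin hcard ⟨y, L, K, hL, hK, hqi⟩ => ?_⟩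
  obtain ⟨x, hx⟩ := hF F hFin
  -- An element of `F` commuting with `g` moves `x` and `g ^ n • x` equally far, so a distance of at
  -- least `M` would contradict acylindricity.
  have hlt : ∀ n : ℤ, dist x (g ^ n • x) < M := by
    intro n
    by_contra! hn
    refine (hcard.trans_le (Set.encard_le_encard ?_)).not_ge (hN x (g ^ n • x) hn)
    rintro h ⟨hh, hc⟩
    refine ⟨hx h hh, ?_⟩
    rw [← mul_smul, (hc.zpow_right n).eq, mul_smul, dist_smul]
    exact hx h hh
  obtain ⟨n, hn⟩ := exists_nat_gt (L * (M + 2 * dist x y + K))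
  have h1 := (hqi 0 n).1
  have h2 : dist y (g ^ (n : ℤ) • y) ≤ M + 2 * dist x y := by
    have := dist_triangle4 y x (g ^ (n : ℤ) • x) (g ^ (n : ℤ) • y)
    rw [dist_smul, dist_comm y x] at this
    linarith [hlt n]
  simp only [zpow_zero, one_smul] at h1
  have h3 : dist (0 : ℤ) (n : ℤ) = n := by simp [Int.dist_eq]
  rw [h3] at h1
  have h4 : (n : ℝ) / L ≤ M + 2 * dist x y + K := by linarith
  rw [div_le_iff₀ (by linarith)] at h4
  linarith

/-! ### Subgroups of Dunwoody's group -/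

namespace Dunwoody

/-- The canonical map from `G_{n+1}` to Dunwoody's group. -/
def ofG (n : ℕ) : G (n + 1) →* J := (QuotientGroup.mk' _).comp (inG n)

/-- The canonical map from `H` to Dunwoody's group. -/
def ofH : H →* J := (QuotientGroup.mk' _).comp inH

theorem ofG_K (n : ℕ) (k : K (n + 1)) :
    ofG n (Subgroup.inclusion (K_le_G (n + 1)) k) =
      ofG (n + 1) (Subgroup.inclusion (K_le_G_succ (n + 1)) k) := by
  have : (QuotientGroup.mk' (Subgroup.normalClosure relators)) _ = 1 :=
    (QuotientGroup.eq_one_iff _).2 (Subgroup.subset_normalClosure (Or.inl ⟨n, k, rfl⟩))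
  rwa [map_mul, map_inv, mul_inv_eq_one] at this

theorem ofG_HfinToG (n : ℕ) (h : Hfin (n + 1)) :
    ofG n (HfinToG (n + 1) h) = ofH (Subgroup.inclusion (Hfin_le_H (n + 1)) h) := by
  have : (QuotientGroup.mk' (Subgroup.normalClosure relators)) _ = 1 :=
    (QuotientGroup.eq_one_iff _).2 (Subgroup.subset_normalClosure (Or.inr ⟨n, h, rfl⟩))
  rwa [map_mul, map_inv, mul_inv_eq_one] at this

section Lift

variable {P : Type*} [Group P] (f : ∀ n : ℕ, G (n + 1) →* P) (k : H →* P)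

/-- The universal property of Dunwoody's group. -/
def lift (hK : ∀ (n : ℕ) (x : K (n + 1)), f n (Subgroup.inclusion (K_le_G (n + 1)) x) =
      f (n + 1) (Subgroup.inclusion (K_le_G_succ (n + 1)) x))
    (hH : ∀ (n : ℕ) (h : Hfin (n + 1)), f n (HfinToG (n + 1) h) =
      k (Subgroup.inclusion (Hfin_le_H (n + 1)) h)) : J →* P :=
  QuotientGroup.lift (Subgroup.normalClosure relators)
    (Monoid.Coprod.lift (Monoid.CoprodI.lift f) k) <| by
    refine Subgroup.normalClosure_le_normal (N := MonoidHom.ker _) ?_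
    rintro _ (⟨n, x, rfl⟩ | ⟨n, h, rfl⟩)
    · rw [SetLike.mem_coe, MonoidHom.mem_ker, map_mul, map_inv, mul_inv_eq_one]
      simpa [inG] using hK n x
    · rw [SetLike.mem_coe, MonoidHom.mem_ker, map_mul, map_inv, mul_inv_eq_one]
      simpa [inG, inH] using hH n h

variable {f k} (hK : ∀ (n : ℕ) (x : K (n + 1)), f n (Subgroup.inclusion (K_le_G (n + 1)) x) =
      f (n + 1) (Subgroup.inclusion (K_le_G_succ (n + 1)) x))
    (hH : ∀ (n : ℕ) (h : Hfin (n + 1)), f n (HfinToG (n + 1) h) =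
      k (Subgroup.inclusion (Hfin_le_H (n + 1)) h))

@[simp]
theorem lift_ofG (n : ℕ) (x : G (n + 1)) : lift f k hK hH (ofG n x) = f n x := by
  change Monoid.Coprod.lift (Monoid.CoprodI.lift f) k (inG n x) = _
  simp [inG]

@[simp]
theorem lift_ofH (x : H) : lift f k hK hH (ofH x) = k x := by
  change Monoid.Coprod.lift (Monoid.CoprodI.lift f) k (inH x) = _
  simp [inH]

end Lift

theorem hom_ext {P : Type*} [Group P] {f g : J →* P} (hG : ∀ n x, f (ofG n x) = g (ofG n x))
    (hH : ∀ x, f (ofH x) = g (ofH x)) : f = g := by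
  refine QuotientGroup.monoidHom_ext _ (Monoid.Coprod.hom_ext ?_ ?_)
  · exact Monoid.CoprodI.ext_hom _ _ fun n => MonoidHom.ext fun x => hG n x
  · exact MonoidHom.ext fun x => hH x

/-- By the universal property the identity of `J` factors through `S`. -/
theorem eq_top_of_range_le {S : Subgroup J} (hG : ∀ n, (ofG n).range ≤ S)
    (hH : ofH.range ≤ S) : S = ⊤ := by
  have hf : ∀ n, ∀ x, ofG n x ∈ S := fun n x => hG n ⟨x, rfl⟩
  have hk : ∀ x, ofH x ∈ S := fun x => hH ⟨x, rfl⟩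
  let r : J →* S := lift (fun n => (ofG n).codRestrict S (hf n)) (ofH.codRestrict S hk)
    (fun n x => Subtype.ext (ofG_K n x)) (fun n h => Subtype.ext (ofG_HfinToG n h))
  have h : S.subtype.comp r = MonoidHom.id J := hom_ext (by simp [r]) (by simp [r])
  refine eq_top_iff.2 fun x _ => ?_
  have : (r x : J) = x := DFunLike.congr_fun h x
  rw [← this]
  exact (r x).2

/-- The canonical map from Dunwoody's group to the semidirect product of `V` with the group of all
permutations of `ℤ`. -/
def toW : J →* W :=
  lift (fun n => (G (n + 1)).subtype) (SemidirectProduct.inr.comp H.subtype)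
    (fun _ _ => rfl) (fun _ _ => rfl)

@[simp]
theorem toW_ofG (n : ℕ) (x : G (n + 1)) : toW (ofG n x) = x := lift_ofG _ _ n x

@[simp]
theorem toW_ofH (x : H) : toW (ofH x) = SemidirectProduct.inr (x : Equiv.Perm ℤ) := lift_ofH _ _ x

theorem ofH_injective : Function.Injective ofH := fun x y h => by
  have := congrArg toW h
  rw [toW_ofH, toW_ofH] at this
  exact Subtype.ext (SemidirectProduct.inr_injective this)

instance (i : ℕ) : Finite (Hfin i) := by
  refine Finite.of_injective (β := Set.Icc (-(i : ℤ)) i → Set.Icc (-(i : ℤ)) i)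
    (fun h j => ⟨h.1 j, (Hfin_apply_mem_iff h.2 j).2 j.2⟩) fun h h' e => ?_
  refine Subtype.ext (Equiv.ext fun j => ?_)
  by_cases hj : j ∈ Set.Icc (-(i : ℤ)) i
  · exact congrArg Subtype.val (congrFun e ⟨j, hj⟩)
  · rw [h.2 j hj, h'.2 j hj]

instance (i : ℕ) : Finite (Vfin i) := by
  refine Finite.of_injective (β := Set.Icc (-(i : ℤ)) i → ℤˣ) (fun v j => v.1 j) fun v v' e => ?_
  refine Subtype.ext (funext fun j => ?_)
  by_cases hj : j ∈ Set.Icc (-(i : ℤ)) i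
  · exact congrFun e ⟨j, hj⟩
  · rw [v.2 j hj, v'.2 j hj]

instance (i : ℕ) : Finite (G i) := by
  refine Finite.of_injective (β := Vfin i × Hfin i)
    (fun x => (⟨x.1.left, x.2.1⟩, ⟨x.1.right, x.2.2⟩)) fun x y e => ?_
  simp only [Prod.mk.injEq, Subtype.mk.injEq] at e
  exact Subtype.ext (SemidirectProduct.ext e.1 e.2)

instance (i : ℕ) : Finite (K i) :=
  Finite.of_injective _ (Subgroup.inclusion_injective (K_le_G i))

/-- The inclusion of `V_i` in `G_i`. -/
def VfinToG (i : ℕ) : Vfin i →* G i :=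
  (SemidirectProduct.inl.comp (Vfin i).subtype).codRestrict (G i)
    fun v => ⟨v.2, (Hfin i).one_mem⟩

theorem VfinToG_mul_HfinToG (i : ℕ) (x : G i) :
    VfinToG i ⟨x.1.left, x.2.1⟩ * HfinToG i ⟨x.1.right, x.2.2⟩ = x :=
  Subtype.ext (SemidirectProduct.inl_left_mul_inr_right x.1)

theorem HfinToG_conj (i : ℕ) (h : Hfin i) (v : Vfin i) :
    HfinToG i h * VfinToG i v * (HfinToG i h)⁻¹ =
      VfinToG i ⟨permAction h v, permAction_mem_Vfin i h h.2 v v.2⟩ := by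
  refine Subtype.ext ?_
  change SemidirectProduct.inr h.1 * SemidirectProduct.inl v.1 * (SemidirectProduct.inr h.1)⁻¹ =
    SemidirectProduct.inl (permAction h.1 v.1)
  rw [SemidirectProduct.inl_aut, map_inv]

end Dunwoody

/-! ### Finite generation of Dunwoody's group -/

namespace Dunwoody

theorem permAction_mulSingle (h : Equiv.Perm ℤ) (a : ℤ) (c : ℤˣ) :
    permAction h (Pi.mulSingle a c) = Pi.mulSingle (h a) c := by
  funext j
  rw [permAction_apply, Pi.mulSingle_apply, Pi.mulSingle_apply]
  exact if_congr Equiv.Perm.inv_eq_iff_eq rfl rfl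

theorem mulSingle_mem_Vfin {i : ℕ} {a : ℤ} (ha : a ∈ Set.Icc (-(i : ℤ)) i) (c : ℤˣ) :
    (Pi.mulSingle a c : V) ∈ Vfin i := fun j hj =>
  Pi.mulSingle_eq_of_ne (M := fun _ : ℤ => ℤˣ) (fun h : j = a => hj (h ▸ ha)) c

theorem swap_mem_Hfin {i : ℕ} {a b : ℤ} (ha : a ∈ Set.Icc (-(i : ℤ)) i)
    (hb : b ∈ Set.Icc (-(i : ℤ)) i) : Equiv.swap a b ∈ Hfin i := fun j hj =>
  Equiv.swap_apply_of_ne_of_ne (fun h => hj (by rwa [h])) (fun h => hj (by rwa [h]))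

theorem prod_mulSingle_Icc {i : ℕ} {v : V} (hv : v ∈ Vfin i) :
    ∏ a ∈ Finset.Icc (-(i : ℤ)) i, (Pi.mulSingle a (v a) : V) = v := by
  funext j
  rw [Finset.prod_apply]
  simp only [Pi.mulSingle_apply, Finset.prod_ite_eq]
  split_ifs with h
  · rfl
  · exact (hv j (by simpa using h)).symm

theorem z_apply_of_mem {i : ℕ} {j : ℤ} (hj : j ∈ Set.Icc (-(i : ℤ)) i) : z i j = -1 := if_pos hj

theorem z_mul_permAction_swap {i : ℕ} {a : ℤ} (ha : a ∈ Set.Icc (-(i : ℤ)) i) :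
    z i * permAction (Equiv.swap a (i + 1)) (z i) =
      Pi.mulSingle a (-1) * Pi.mulSingle ((i : ℤ) + 1) (-1) := by
  obtain ⟨h1, h2⟩ := ha
  funext j
  simp only [Pi.mul_apply, permAction_apply, Equiv.swap_inv, Pi.mulSingle_apply]
  rcases eq_or_ne j a with rfl | hja
  · rw [Equiv.swap_apply_left, z_apply_of_mem ⟨h1, h2⟩, z_mem_Vfin i _ (by simp)]
    rw [if_pos rfl, if_neg (by omega)]
  rcases eq_or_ne j (i + 1) with rfl | hji
  · rw [Equiv.swap_apply_right, z_apply_of_mem ⟨h1, h2⟩, z_mem_Vfin i _ (by simp)]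
    rw [if_neg (by omega), if_pos rfl]
  · rw [Equiv.swap_apply_of_ne_of_ne hja hji, Int.units_mul_self, if_neg hja, if_neg hji, one_mul]

/-- A subgroup of `V` which contains `z_i` and is invariant under `H_{i+1}` contains `V_{i+1}`. -/
theorem Vfin_succ_le {i : ℕ} {D : Subgroup V} (hz : z i ∈ D)
    (hD : ∀ h ∈ Hfin (i + 1), ∀ v ∈ D, permAction h v ∈ D) : Vfin (i + 1) ≤ D := by
  have hi : (i : ℤ) + 1 ∈ Set.Icc (-((i + 1 : ℕ) : ℤ)) ((i + 1 : ℕ) : ℤ) :=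
    ⟨by push_cast; omega, by push_cast; omega⟩
  have h1 : (Pi.mulSingle ((i : ℤ) + 1) (-1) : V) ∈ D := by
    -- There are `2 * i + 1` factors, an odd number, so the sign changes at `i + 1` leave a single
    -- one, multiplied by `z i`.
    have hprod : ∏ a ∈ Finset.Icc (-(i : ℤ)) i,
        ((Pi.mulSingle a (-1) : V) * Pi.mulSingle ((i : ℤ) + 1) (-1)) ∈ D := by
      refine D.prod_mem fun a ha => ?_
      have ha := Finset.mem_Icc.1 ha
      rw [← z_mul_permAction_swap ha]
      exact D.mul_mem hz (hD _ (swap_mem_Hfin (Icc_subset_succ i ha) hi) _ hz)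
    have e1 : ∏ a ∈ Finset.Icc (-(i : ℤ)) i, (Pi.mulSingle a (-1) : V) = z i := by
      rw [← prod_mulSingle_Icc (z_mem_Vfin i)]
      exact Finset.prod_congr rfl fun a ha => by rw [z_apply_of_mem (Finset.mem_Icc.1 ha)]
    have e2 : (Finset.Icc (-(i : ℤ)) i).card = 2 * i + 1 := by
      rw [Int.card_Icc]; omega
    have e3 : (Pi.mulSingle ((i : ℤ) + 1) (-1) : V) ^ 2 = 1 := by
      rw [← Pi.mulSingle_pow]; simp
    rw [Finset.prod_mul_distrib, e1, Finset.prod_const, e2, pow_succ, pow_mul, e3, one_pow,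
      one_mul] at hprod
    exact (D.mul_mem_cancel_left hz).1 hprod
  intro v hv
  rw [← prod_mulSingle_Icc hv]
  refine D.prod_mem fun a ha => ?_
  rcases Int.units_eq_one_or (v a) with h | h
  · rw [h, Pi.mulSingle_one]; exact D.one_mem
  · have := hD _ (swap_mem_Hfin hi (Finset.mem_Icc.1 ha)) _ h1
    rwa [permAction_mulSingle, Equiv.swap_apply_left, ← h] at this

/-- By induction the closure contains `G (n + 1)`, hence `z (n + 1)` through the identification of
`K (n + 1)`. It contains `Hfin (n + 2)` through `H`, and the two generate `G (n + 2)`. -/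
theorem fg : Group.FG J := by
  let S : Set J := Set.range (ofG 0) ∪ ofH '' {x | x.1 = Equiv.swap 0 1 ∨ x.1 = Equiv.addRight 1}
  have hfin : S.Finite := by
    refine (Set.finite_range _).union (Set.Finite.image _ ?_)
    refine Set.Finite.of_finite_image (f := Subtype.val) ?_ Subtype.val_injective.injOn
    refine (Set.toFinite {Equiv.swap 0 1, Equiv.addRight 1}).subset ?_
    rintro _ ⟨x, hx, rfl⟩
    exact hx
  have hH : ∀ x, ofH x ∈ Subgroup.closure S := by
    rintro ⟨x, hx⟩
    refine Subgroup.closure_induction (p := fun y hy => ofH ⟨y, hy⟩ ∈ Subgroup.closure S)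
      (fun y hy => Subgroup.subset_closure (Or.inr ⟨⟨y, Subgroup.subset_closure hy⟩, hy, rfl⟩))
      ?_ (fun y y' hy hy' h h' => ?_) (fun y hy h => ?_) hx
    · exact (map_one ofH).symm ▸ one_mem _
    · exact (map_mul ofH ⟨y, hy⟩ ⟨y', hy'⟩).symm ▸ mul_mem h h'
    · exact (map_inv ofH ⟨y, hy⟩).symm ▸ inv_mem h
  have hG : ∀ n x, ofG n x ∈ Subgroup.closure S := by
    intro n
    induction n with
    | zero => exact fun x => Subgroup.subset_closure (Or.inl ⟨x, rfl⟩)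
    | succ n ih =>
      have hHfin : ∀ h, ofG (n + 1) (HfinToG (n + 2) h) ∈ Subgroup.closure S := fun h => by
        rw [ofG_HfinToG]; exact hH _
      let D : Subgroup V := ((Subgroup.closure S).comap
        ((ofG (n + 1)).comp (VfinToG (n + 2)))).map (Vfin (n + 2)).subtype
      have hD : Vfin (n + 2) ≤ D := by
        refine Vfin_succ_le ?_ ?_
        · refine ⟨⟨z (n + 1), Vfin_le_succ _ (z_mem_Vfin _)⟩, Subgroup.mem_comap.2 ?_, rfl⟩
          have := ofG_K n ⟨SemidirectProduct.inl (z (n + 1)),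
            Subgroup.mem_zpowers _, (Hfin (n + 1)).one_mem⟩
          change ofG (n + 1) (VfinToG (n + 2) ⟨z (n + 1), _⟩) ∈ Subgroup.closure S
          exact Eq.mp (congrArg (· ∈ Subgroup.closure S) this) (ih _)
        · rintro h hh _ ⟨v, hv, rfl⟩
          refine ⟨⟨permAction h v, permAction_mem_Vfin _ h hh v v.2⟩,
            Subgroup.mem_comap.2 ?_, rfl⟩
          rw [MonoidHom.comp_apply, ← HfinToG_conj (n + 2) ⟨h, hh⟩ v, map_mul, map_mul, map_inv]
          exact mul_mem (mul_mem (hHfin _) hv) (inv_mem (hHfin _))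
      intro x
      rw [← VfinToG_mul_HfinToG (n + 2) x, map_mul]
      refine mul_mem ?_ (hHfin _)
      obtain ⟨v, hv, hvx⟩ := hD x.2.1
      rwa [show (⟨x.1.left, x.2.1⟩ : Vfin (n + 2)) = v from Subtype.ext hvx.symm]
  refine ⟨(Subgroup.fg_iff _).2 ⟨S, eq_top_of_range_le ?_ ?_, hfin⟩⟩
  · rintro n _ ⟨x, rfl⟩
    exact hG n x
  · rintro _ ⟨x, rfl⟩
    exact hH x

/-! ### Splittings over the groups `K_i` and generalized loxodromic elements -/

/-- The map from `K_{n+1}` to Dunwoody's group. -/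
def ofK (n : ℕ) : K (n + 1) →* J := (ofG n).comp (Subgroup.inclusion (K_le_G (n + 1)))

theorem ofG_HfinToG_mem_range_ofK {m n : ℕ} (hmn : m ≤ n) (h : Hfin (m + 1)) :
    ofG m (HfinToG (m + 1) h) ∈ (ofK n).range := by
  have hle : Hfin (m + 1) ≤ Hfin (n + 1) :=
    monotone_nat_of_le_succ Hfin_le_succ (Nat.succ_le_succ hmn)
  refine ⟨⟨SemidirectProduct.inr h.1, Subgroup.one_mem _, hle h.2⟩, ?_⟩
  rw [ofG_HfinToG]
  exact ofG_HfinToG n ⟨h.1, hle h.2⟩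

/-- The amalgamated product of two copies of Dunwoody's group over the image of `K_{n+1}`. -/
abbrev Double (n : ℕ) : Type :=
  Monoid.PushoutI (G := fun _ : Bool => J) fun _ : Bool => (ofK n).range.subtype

theorem of_false_eq_of_true (n : ℕ) {x : J} (hx : x ∈ (ofK n).range) :
    (Monoid.PushoutI.of false x : Double n) = Monoid.PushoutI.of true x :=
  (Monoid.PushoutI.of_apply_eq_base (fun _ : Bool => (ofK n).range.subtype) false ⟨x, hx⟩).trans
    (Monoid.PushoutI.of_apply_eq_base (fun _ : Bool => (ofK n).range.subtype) true ⟨x, hx⟩).symm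

/-- The homomorphism from Dunwoody's group to its double, which maps the groups `G_i` with
`i ≤ n + 1` to the first copy and the other factors to the second one. -/
noncomputable def toDouble (n : ℕ) : J →* Double n :=
  lift (fun m => (Monoid.PushoutI.of (decide (n < m))).comp (ofG m))
    ((Monoid.PushoutI.of true).comp ofH)
    (by
      intro m x
      rw [MonoidHom.comp_apply, MonoidHom.comp_apply, ← ofG_K]
      -- Consecutive factors go to different copies only for `m = n`, and there they meet in the
      -- image of `K (n + 1)`, over which the double is amalgamated.
      rcases lt_trichotomy n m with h | rfl | h
      · rw [decide_eq_true h, decide_eq_true (by omega : n < m + 1)]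
      · rw [decide_eq_false (lt_irrefl n), decide_eq_true (Nat.lt_succ_self n)]
        exact of_false_eq_of_true n ⟨x, rfl⟩
      · rw [decide_eq_false (by omega : ¬ n < m), decide_eq_false (by omega : ¬ n < m + 1)])
    (by
      intro m h
      rw [MonoidHom.comp_apply, MonoidHom.comp_apply, ← ofG_HfinToG]
      by_cases hmn : n < m
      · rw [decide_eq_true hmn]
      · rw [decide_eq_false hmn]
        exact of_false_eq_of_true n (ofG_HfinToG_mem_range_ofK (not_lt.1 hmn) h))

theorem toDouble_ofG (n m : ℕ) (x : G (m + 1)) :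
    toDouble n (ofG m x) = Monoid.PushoutI.of (decide (n < m)) (ofG m x) := lift_ofG _ _ m x

/-- Folding the two copies together is a left inverse. Thus `J` inherits an acylindrical action from
the double without being identified with an amalgamated product itself. -/
theorem toDouble_injective (n : ℕ) : Function.Injective (toDouble n) := by
  let fold : Double n →* J :=
    Monoid.PushoutI.lift (fun _ => MonoidHom.id J) (ofK n).range.subtype fun _ => rfl
  have h : fold.comp (toDouble n) = MonoidHom.id J := by
    refine hom_ext (fun m x => ?_) (fun x => ?_)
    · rw [MonoidHom.comp_apply, toDouble_ofG]
      exact Monoid.PushoutI.lift_of _ _ _ _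
    · rw [MonoidHom.comp_apply, toDouble, lift_ofH]
      exact Monoid.PushoutI.lift_of _ _ _ _
  exact Function.LeftInverse.injective (g := fold) fun x => DFunLike.congr_fun h x

theorem apply_eq_of_mem_zpowers_z {i : ℕ} {v : V} (hv : v ∈ Subgroup.zpowers (z i)) {j k : ℤ}
    (hj : j ∈ Set.Icc (-(i : ℤ)) i) (hk : k ∈ Set.Icc (-(i : ℤ)) i) : v j = v k := by
  obtain ⟨n, rfl⟩ := hv
  simp only [Pi.pow_apply, z_apply_of_mem hj, z_apply_of_mem hk]

/-- Membership in the image of `K (n + 1)` is tested in the concrete group `W`, by means of `toW`.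
-/
theorem left_mem_zpowers_of_mem_range_ofK {n m : ℕ} {v : Vfin (m + 1)}
    (h : ofG m (VfinToG (m + 1) v) ∈ (ofK n).range) : v.1 ∈ Subgroup.zpowers (z (n + 1)) := by
  obtain ⟨k, hk⟩ := h
  have h := congrArg (fun x => (toW x).left) hk
  simp only [ofK, MonoidHom.comp_apply, toW_ofG] at h
  exact (show k.1.left = v.1 from h) ▸ k.2.1

theorem commute_ofH_ofG {m : ℕ} {h : Equiv.Perm ℤ} (hh : h ∈ Hfin (m + 1)) {a : ℤ} (ha : h a = a)
    (ham : a ∈ Set.Icc (-((m + 1 : ℕ) : ℤ)) ((m + 1 : ℕ) : ℤ)) :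
    Commute (ofH ⟨h, Hfin_le_H _ hh⟩)
      (ofG m (VfinToG (m + 1) ⟨Pi.mulSingle a (-1), mulSingle_mem_Vfin ham _⟩)) := by
  have h1 : ofH ⟨h, Hfin_le_H _ hh⟩ = ofG m (HfinToG (m + 1) ⟨h, hh⟩) :=
    (ofG_HfinToG m ⟨h, hh⟩).symm
  have h2 := HfinToG_conj (m + 1) ⟨h, hh⟩ ⟨Pi.mulSingle a (-1), mulSingle_mem_Vfin ham _⟩
  simp only [permAction_mulSingle, ha, mul_inv_eq_iff_eq_mul] at h2
  rw [h1, commute_iff_eq, ← map_mul, ← map_mul, h2]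

/-- There are generalized loxodromic elements of Dunwoody's group which commute with arbitrarily
many elements of a finite subgroup. -/
theorem exists_isGeneralizedLoxodromic_commute (n : ℕ) :
    ∃ (g : J) (F : Subgroup J), IsGeneralizedLoxodromic.{v} g ∧ Finite F ∧
      (n : ℕ∞) ≤ {h | h ∈ F ∧ Commute h g}.encard := by
  have h0 : (0 : ℤ) ∈ Set.Icc (-((n + 1 : ℕ) : ℤ)) ((n + 1 : ℕ) : ℤ) :=
    ⟨by push_cast; omega, by push_cast; omega⟩
  have hn2 : (n : ℤ) + 2 ∈ Set.Icc (-((n + 1 + 1 : ℕ) : ℤ)) ((n + 1 + 1 : ℕ) : ℤ) :=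
    ⟨by push_cast; omega, by push_cast; omega⟩
  have h1 : (1 : ℤ) ∈ Set.Icc (-((n + 1 : ℕ) : ℤ)) ((n + 1 : ℕ) : ℤ) :=
    ⟨by push_cast; omega, by push_cast; omega⟩
  -- Powers of `z (n + 1)` are constant on `[-(n + 1), n + 1]` and trivial outside it: the first
  -- property excludes `a` from `K (n + 1)`, the second excludes `b`.
  let a : J := ofG n (VfinToG (n + 1) ⟨Pi.mulSingle 0 (-1), mulSingle_mem_Vfin h0 _⟩)
  let b : J := ofG (n + 1)
    (VfinToG (n + 1 + 1) ⟨Pi.mulSingle ((n : ℤ) + 2) (-1), mulSingle_mem_Vfin hn2 _⟩)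
  refine ⟨a * b, (ofH.comp (Subgroup.inclusion (Hfin_le_H (n + 1)))).range, ?_,
    Finite.of_surjective _ (MonoidHom.rangeRestrict_surjective _), ?_⟩
  · refine IsGeneralizedLoxodromic.of_injective (toDouble_injective n) ?_
    have hfin : Finite (ofK n).range :=
      Finite.of_surjective _ (MonoidHom.rangeRestrict_surjective _)
    rw [map_mul, toDouble_ofG, toDouble_ofG, decide_eq_false (lt_irrefl n),
      decide_eq_true (Nat.lt_succ_self n)]
    refine Monoid.PushoutI.isGeneralizedLoxodromic_of_mul_of.{v}
      (fun _ => Subtype.val_injective) Bool.false_ne_true ?_ ?_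
    · rw [Subgroup.range_subtype]
      intro hmem
      have := apply_eq_of_mem_zpowers_z (left_mem_zpowers_of_mem_range_ofK hmem) h0 h1
      simp at this
    · rw [Subgroup.range_subtype]
      intro hmem
      have := Subgroup.zpowers_le.2 (z_mem_Vfin (n + 1)) (left_mem_zpowers_of_mem_range_ofK hmem)
        ((n : ℤ) + 2) (by simp)
      simp at this
  · have hk : ∀ k : Fin n, (k : ℤ) + 2 ∈ Set.Icc (-((n + 1 : ℕ) : ℤ)) ((n + 1 : ℕ) : ℤ) :=
      fun k => ⟨by push_cast; omega, by push_cast; omega⟩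
    -- These transpositions move only points of `[1, n + 1]`, so they fix `0` and `n + 2` and
    -- commute with `a` and `b`.
    let f : Fin n → J := fun k =>
      ofH ⟨Equiv.swap 1 ((k : ℤ) + 2), Hfin_le_H _ (swap_mem_Hfin h1 (hk k))⟩
    have hf : Function.Injective f := fun k l hkl => by
      have := congrArg (fun x : H => x.1 1) (ofH_injective hkl)
      simp only [Equiv.swap_apply_left] at this
      exact Fin.ext (by omega)
    have hcard : (n : ℕ∞) ≤ (Set.range f).encard := by simpa using hf.encard_range
    refine hcard.trans (Set.encard_le_encard ?_)
    rintro _ ⟨k, rfl⟩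
    have hs := swap_mem_Hfin h1 (hk k)
    exact ⟨⟨⟨_, hs⟩, rfl⟩, (commute_ofH_ofG hs (Equiv.swap_apply_of_ne_of_ne (by omega) (by omega))
      h0).mul_right (commute_ofH_ofG (Hfin_le_succ _ hs)
        (Equiv.swap_apply_of_ne_of_ne (by omega) (by omega)) hn2)⟩

end Dunwoody

/-- Dunwoody's group is finitely generated and has no universal acylindrical action. -/
theorem theorem1 :
    Group.FG Dunwoody.J ∧ ¬ HasUniversalAcylindricalAction.{u, v, 0} Dunwoody.J := by
  refine ⟨Dunwoody.fg, ?_⟩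
  rintro ⟨X, _, _, _, hhyp, hac, huniv⟩
  obtain ⟨N, hN⟩ := hac.exists_not_isLoxodromic hhyp
  obtain ⟨g, F, hg, hF, hcard⟩ := Dunwoody.exists_isGeneralizedLoxodromic_commute (N + 1)
  refine hN F g hF (lt_of_lt_of_le ?_ hcard) (huniv g hg)
  exact_mod_cast Nat.lt_succ_self N
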